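/- Let $M$ be a compact connected smooth manifold (Hausdorff, without boundary) such that $H_1(M;\mathbb Z)$ is free with basis $\Gamma_1,\dots,\Gamma_b$. Let $\pi:\tilde M\to M$ be the universal Abelian cover, that is, a path-connected covering with $\pi_*(\pi_1(\tilde M,\tilde x))=[\pi_1(M,\pi\tilde x),\pi_1(M,\pi\tilde x)]$ for all $\tilde x\in\tilde M$. For $\vec n\in\mathbb Z^b$ let $\delta_{\vec n}$ be the deck transformation that moves each $\tilde x$ to the end point of any path starting at $\tilde x$ whose projection is a closed loop of homology class $\sum_j n_j\Gamma_j$. Let $\omega_1,\dots,\omega_b$ be smooth closed one-forms on $M$ (for example, harmonic one-forms of a Riemannian metric) with $\int_{\Gamma_j}\omega_i=\delta_{ij}$, fix $\tilde x_0\in\tilde M$, and define $\tilde\iota:\tilde M\to\mathbb R^b$ by $\tilde\iota_i(\tilde x)=\int_\gamma\pi^*\omega_i$, where $\gamma$ is any smooth path from $\tilde x_0$ to $\tilde x$. Let $f:M\to M$ be continuous, let $\tilde f:\tilde M\to\tilde M$ be a continuous lift of $f$, and let $A\in M_b(\mathbb Z)$ be the matrix of $f_*$ on $H_1(M;\mathbb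 Z)$ in the basis $\Gamma_1,\dots,\Gamma_b$. Assume that $f$ is $H_1$-expanding: every complex eigenvalue $\mu$ of $A$ satisfies $|\mu|>1$. Then $A^k$ is invertible over $\mathbb R$ for every $k\ge 0$, $A^k-I$ is invertible over $\mathbb R$ for every $k\ge1$, and the following hold. 1. The limit $\tilde\beta(\tilde x)=\lim_{k\to\infty}A^{-k}\,\tilde\iota(\tilde f^k(\tilde x))$ exists for every $\tilde x\in\tilde M$, and $\tilde\beta$ descends to a continuous map $\beta:M\to\mathbb T^b=\mathbb R^b/\mathbb Z^b$ with $\beta\circ f=\Phi_A\circ\beta$, where $\Phi_A$ is the toral endomorphism induced by $A$. 2. Let $\tilde M_0\subset\tilde M$ be a connected, relatively compact fundamental domain, so that $\tilde M=\bigsqcup_{\vec n\in\mathbb Z^b}\tilde M_{\vec n}$ with $\tilde M_{\vec n}=\delta_{\vec n}\tilde M_0$; write $\lfloor\tilde x\rfloor=\vec n$ if $\tilde x\in\tilde M_{\vec n}$, and let $d_k(\tilde x)=\lfloor\tilde f^k(\tilde x)\rfloor-\lfloor\tilde x\rfloor\in\mathbb Z^b$. Then for every $\tilde x\in\tilde M$,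 $$\lim_{k\to\infty}(A^k-I)^{-1}d_k(\tilde x)=\tilde\beta(\tilde x).$$ 3. The maps $\tilde\beta$ and $\beta$ do not depend on the choice of the one-forms $\omega_i$ with $\int_{\Gamma_j}\omega_i=\delta_{ij}$, nor on the base point $\tilde x_0$, used to define $\tilde\iota$. -/

import Mathlib

open Filter Topology Set
open scoped Manifold ContDiff unitInterval Simplicial

noncomputable section

namespace AbelianCover

universe u v

/-! ### First integral singular homology -/

section Homology

open CategoryTheory AlgebraicTopology

/-- The coefficient group `ℤ`, placed in the universe of the spaces considered. -/
abbrev coeffZ : ModuleCat.{u} ℤ := ModuleCat.of ℤ (ULift.{u} ℤ)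

/-- The first singular homology group `H₁(X; ℤ)`. -/
abbrev H1 (X : Type u) [TopologicalSpace X] : ModuleCat.{u} ℤ :=
  ((singularHomologyFunctor (ModuleCat.{u} ℤ) 1).obj coeffZ.{u}).obj (TopCat.of X)

/-- The map `f_* : H₁(X; ℤ) → H₁(Y; ℤ)` induced by a continuous map `f`. -/
def H1map {X Y : Type u} [TopologicalSpace X] [TopologicalSpace Y] (f : C(X, Y)) :
    H1 X →ₗ[ℤ] H1 Y :=
  (((singularHomologyFunctor (ModuleCat.{u} ℤ) 1).obj coeffZ.{u}).map (TopCat.ofHom f)).hom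

/-- A continuous curve `γ : [0,1] → X`, seen as a singular `1`-simplex of `X` going from
`γ 0` to `γ 1`. -/
def curveSimplex {X : Type u} [TopologicalSpace X] (γ : C(I, X)) :
    (TopCat.toSSet.obj (TopCat.of X)) _⦋1⦌ :=
  ((TopCat.of X).toSSetObjEquiv _).symm
    (γ.comp ⟨stdSimplexHomeomorphUnitInterval, stdSimplexHomeomorphUnitInterval.continuous⟩)

theorem curveSimplex_d {X : Type u} [TopologicalSpace X] (γ : C(I, X)) (h : γ 0 = γ 1) :
    (TopCat.toSSet.obj (TopCat.of X)).ιChainComplex (R := coeffZ.{u}) (curveSimplex γ) ≫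
      ((TopCat.toSSet.obj (TopCat.of X)).chainComplex coeffZ.{u}).d 1 0 = 0 := by
  have key : (TopCat.toSSet.obj (TopCat.of X)).δ 0 (curveSimplex γ) =
      (TopCat.toSSet.obj (TopCat.of X)).δ 1 (curveSimplex γ) := by
    refine TopCat.toSSetObj₀Equiv.injective ?_
    have hv (i j : Fin 2) (hij : i.succAbove 0 = j) :
        stdSimplex.map (S := ℝ) i.succAbove (default : stdSimplex ℝ (Fin 1)) =
          stdSimplex.vertex j := by
      rw [Subsingleton.elim (default : stdSimplex ℝ (Fin 1)) (stdSimplex.vertex 0),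
        stdSimplex.map_vertex, hij]
    have h0 : TopCat.toSSetObj₀Equiv ((TopCat.toSSet.obj (TopCat.of X)).δ 0 (curveSimplex γ)) =
        γ 1 := by
      rw [← stdSimplexHomeomorphUnitInterval_one]
      exact congrArg (fun z => γ (stdSimplexHomeomorphUnitInterval z)) (hv 0 1 rfl)
    have h1 : TopCat.toSSetObj₀Equiv ((TopCat.toSSet.obj (TopCat.of X)).δ 1 (curveSimplex γ)) =
        γ 0 := by
      rw [← stdSimplexHomeomorphUnitInterval_zero]
      exact congrArg (fun z => γ (stdSimplexHomeomorphUnitInterval z)) (hv 1 0 rfl)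
    rw [h0, h1, h]
  rw [SSet.ιChainComplex_d]
  simp [Fin.sum_univ_two, key]

/-- The homology class in `H₁(X; ℤ)` of a closed curve `γ`. -/
def loopClass {X : Type u} [TopologicalSpace X] (γ : C(I, X)) (h : γ 0 = γ 1) : H1 X :=
  (((TopCat.toSSet.obj (TopCat.of X)).chainComplex coeffZ.{u}).liftCycles
      ((TopCat.toSSet.obj (TopCat.of X)).ιChainComplex (curveSimplex γ)) 0 (by simp)
      (curveSimplex_d γ h) ≫
    ((TopCat.toSSet.obj (TopCat.of X)).chainComplex coeffZ.{u}).homologyπ 1).hom (ULift.up 1)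

/-- The integer matrix of `f_*` on `H₁(X; ℤ)` in the basis `Γ`. -/
def homologyMatrix {X : Type u} [TopologicalSpace X] {b : ℕ} (Γ : Module.Basis (Fin b) ℤ (H1 X))
    (f : C(X, X)) : Matrix (Fin b) (Fin b) ℤ :=
  LinearMap.toMatrix Γ Γ (H1map f)

end Homology

/-! ### Closed one-forms and their integrals along smooth paths -/

section Forms

variable {n : ℕ} {M : Type u} [TopologicalSpace M] [ChartedSpace (EuclideanSpace ℝ (Fin n)) M]

/-- The expression in the chart around `x₀` of a field of covectors `η` on `M`. -/
def chartRep (η : (x : M) → TangentSpace (𝓡 n) x →L[ℝ] ℝ) (x₀ : M)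
    (y : EuclideanSpace ℝ (Fin n)) : EuclideanSpace ℝ (Fin n) →L[ℝ] ℝ :=
  (η ((extChartAt (𝓡 n) x₀).symm y)).comp
    (mfderiv 𝓘(ℝ, EuclideanSpace ℝ (Fin n)) (𝓡 n) (extChartAt (𝓡 n) x₀).symm y)

variable (n M) in
/-- A smooth closed one-form on `M`: in every chart its coefficients are `C^∞` and its exterior
derivative vanishes (that is, the derivative of the coefficients is symmetric). -/
structure ClosedOneForm where
  /-- the covector at each point -/
  toFun : (x : M) → TangentSpace (𝓡 n) x →L[ℝ] ℝ
  smooth : ∀ x₀ : M, ContDiffOn ℝ ∞ (chartRep toFun x₀) (extChartAt (𝓡 n) x₀).target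
  closed : ∀ x₀ : M, ∀ y ∈ (extChartAt (𝓡 n) x₀).target, ∀ u v : EuclideanSpace ℝ (Fin n),
    fderiv ℝ (chartRep toFun x₀) y u v = fderiv ℝ (chartRep toFun x₀) y v u

variable (n) in
/-- A path in the manifold `M` that is `C^∞` on `[0,1]`. -/
def IsSmoothPath {a b : M} (γ : Path a b) : Prop :=
  ContMDiffOn 𝓘(ℝ, ℝ) (𝓡 n) ∞ γ.extend (Icc (0 : ℝ) 1)

/-- The integral `∫_γ η` along a smooth path `γ` in `M`. -/
def ClosedOneForm.pathIntegral (η : ClosedOneForm n M) {a b : M} (γ : Path a b) : ℝ :=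
  ∫ t in (0 : ℝ)..1, η.toFun (γ.extend t)
    (mfderivWithin 𝓘(ℝ, ℝ) (𝓡 n) γ.extend (Icc (0 : ℝ) 1) t (1 : ℝ))

open Classical in
/-- The pairing `η(c)` of a closed one-form with a homology class `c`: the integral of `η` along a
smooth loop in the class `c`. -/
def ClosedOneForm.period (η : ClosedOneForm n M) (c : H1 M) : ℝ :=
  if h : ∃ l : (a : M) × Path a a, IsSmoothPath n l.2 ∧
      loopClass (l.2 : C(I, M)) (by simp) = c then
    η.pathIntegral h.choose.2
  else 0

/-- The one-forms `η₁, …, η_b` are dual to the basis `Γ₁, …, Γ_b` of `H₁(M; ℤ)`: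
`η_i(Γ_j) = δ_ij`. -/
def IsDualTo {b : ℕ} (η : Fin b → ClosedOneForm n M) (Γ : Module.Basis (Fin b) ℤ (H1 M)) : Prop :=
  ∀ i j, (η i).period (Γ j) = if i = j then 1 else 0

end Forms

/-! ### The universal Abelian cover -/

section Cover

variable {M : Type u} [TopologicalSpace M] {Mt : Type v} [TopologicalSpace Mt]

/-- `p : Mt → M` is the universal Abelian cover of `M`: a path-connected covering whose fundamental
group is, as a subgroup of the fundamental group of `M`, the commutator subgroup. -/
structure IsUniversalAbelianCover (p : C(Mt, M)) : Prop where
  isCoveringMap : IsCoveringMap p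
  pathConnected : PathConnectedSpace Mt
  range_eq : ∀ x : Mt, (FundamentalGroup.map p x).range = commutator (FundamentalGroup M (p x))

variable {b : ℕ} (Γ : Module.Basis (Fin b) ℤ (H1 M)) (p : C(Mt, M))

open Classical in
/-- The deck transformation `δ_v` for `v ∈ ℤ^b`: it moves `x` to the end point of any path which
starts at `x` and projects to a closed loop in `M` of homology class `∑ v_j Γ_j`. -/
def deck (v : Fin b → ℤ) (x : Mt) : Mt :=
  if h : ∃ y : Mt, ∃ (γ : Path x y) (hy : p x = p y),
      loopClass ((γ.map p.continuous : Path (p x) (p y)) : C(I, M)) (by simp [hy]) =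
        ∑ j, v j • Γ j then
    h.choose
  else x

/-- `M₀` is a connected, relatively compact fundamental domain for the action of `ℤ^b` by deck
transformations: its translates `δ_v M₀` partition the cover. -/
structure IsFundamentalDomain (M₀ : Set Mt) : Prop where
  isConnected : IsConnected M₀
  isCompact_closure : IsCompact (closure M₀)
  iUnion_eq : ⋃ v : Fin b → ℤ, deck Γ p v '' M₀ = univ
  pairwise_disjoint : Pairwise fun v w : Fin b → ℤ => Disjoint (deck Γ p v '' M₀) (deck Γ p w '' M₀)

open Classical in
/-- The index `⌊x⌋ ∈ ℤ^b` of the tile `δ_v M₀` containing `x`. -/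
def tileIndex (M₀ : Set Mt) (x : Mt) : Fin b → ℤ :=
  if h : ∃ v : Fin b → ℤ, x ∈ deck Γ p v '' M₀ then h.choose else 0

/-- The approximate displacement `d_k(x) = ⌊f̃^k(x)⌋ - ⌊x⌋ ∈ ℤ^b`. -/
def displacement (M₀ : Set Mt) (ft : C(Mt, Mt)) (k : ℕ) (x : Mt) : Fin b → ℤ :=
  tileIndex Γ p M₀ (ft^[k] x) - tileIndex Γ p M₀ x

end Cover

/-! ### The maps `ι̃`, `β̃` and `β` -/

section Beta

variable {n b : ℕ} {M : Type u} [TopologicalSpace M] [ChartedSpace (EuclideanSpace ℝ (Fin n)) M]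
  {Mt : Type v} [TopologicalSpace Mt]

open Classical in
/-- The map `ι̃ : Mt → ℝ^b`, whose `i`-th coordinate at `x` is the integral of the lift of `η_i`
along a smooth path from `x₀` to `x`. The cover carries the smooth structure pulled back from `M`,
so that a path is smooth if and only if its projection is, and the integral of the lifted form
along it is the integral of the form along the projected path. -/
def abelJacobi (p : C(Mt, M)) (η : Fin b → ClosedOneForm n M) (x₀ x : Mt) : Fin b → ℝ := fun i =>
  if h : ∃ γ : Path x₀ x, IsSmoothPath n (γ.map p.continuous) then
    (η i).pathIntegral (h.choose.map p.continuous)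
  else 0

/-- The real matrix with the same entries as an integer matrix. -/
abbrev realMatrix (A : Matrix (Fin b) (Fin b) ℤ) : Matrix (Fin b) (Fin b) ℝ :=
  A.map (Int.cast : ℤ → ℝ)

/-- A matrix is expanding if all its (complex) eigenvalues lie outside the closed unit disc. -/
def IsExpanding (A : Matrix (Fin b) (Fin b) ℤ) : Prop :=
  ∀ μ : ℂ, Module.End.HasEigenvalue (Matrix.toLin' (A.map (Int.cast : ℤ → ℂ))) μ → 1 < ‖μ‖

/-- The map `β̃ = lim A^{-k} ι̃ f̃^k`. -/
def betaLift (A : Matrix (Fin b) (Fin b) ℤ) (p : C(Mt, M)) (η : Fin b → ClosedOneForm n M)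
    (x₀ : Mt) (ft : C(Mt, Mt)) (x : Mt) : Fin b → ℝ :=
  limUnder atTop fun k : ℕ => ((realMatrix A) ^ k)⁻¹.mulVec (abelJacobi p η x₀ (ft^[k] x))

/-- The torus `𝕋^b = (ℝ/ℤ)^b`. -/
abbrev Torus (b : ℕ) : Type := Fin b → UnitAddCircle

/-- The projection `ℝ^b → 𝕋^b`. -/
def toTorus (v : Fin b → ℝ) : Torus b := fun i => (v i : UnitAddCircle)

/-- The toral endomorphism `Φ_A` induced by an integer matrix `A`. -/
def toralEndo (A : Matrix (Fin b) (Fin b) ℤ) (θ : Torus b) : Torus b :=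
  fun i => ∑ j, A i j • θ j

open Classical in
/-- The map `β : M → 𝕋^b` to which `β̃` descends: `β(x)` is the projection of `β̃(x̃)` for a lift
`x̃` of `x`. -/
def beta (A : Matrix (Fin b) (Fin b) ℤ) (p : C(Mt, M)) (η : Fin b → ClosedOneForm n M)
    (x₀ : Mt) (ft : C(Mt, Mt)) (x : M) : Torus b :=
  if h : ∃ xt : Mt, p xt = x then toTorus (betaLift A p η x₀ ft h.choose) else 0

end Beta

end AbelianCover

end

noncomputable section

namespace AbelianCover

universe u v

/-! ### Local potentials and their integrals along continuous curves -/

/-! By duality the forms integrate to `v` along a loop of class `∑ v_j Γ_j`, so the Abel–Jacobi map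
`J = ι̃` moves by `v` under translation by `v`, while `f̃` carries a `v`-translate to an
`Av`-translate. Hence `g = A⁻¹ J∘f̃ - J` is constant on the fibres of `p`, and bounded because `M`
is compact. Telescoping gives `A⁻ᵏ J∘f̃ᵏ = J + ∑_{j<k} A⁻ʲ g∘f̃ʲ`, and `∑ ‖A⁻ʲ‖ < ∞` since the
spectral radius of `A⁻¹` is below 1. The convergence is uniform up to the fixed term `J`, so the
limit is continuous, equivariant and satisfies `β̃∘f̃ = A β̃` (`IsEquivariant.exists_tendsto`).

The other claims rest on `A⁻ᵏ` killing bounded errors: two Abel–Jacobi maps differ by a bounded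
function, and so do `J` and the tile index. The relation `q = A⁻ᵏ d + A⁻ᵏ q` for `q = (Aᵏ - 1)⁻¹ d`
replaces `A⁻ᵏ` by `(Aᵏ - 1)⁻¹`.

Most of the work is the equivariance of `J`. The loops that carry homology classes are only
continuous, so a closed form is replaced by its local primitives, which can be integrated along any
continuous curve. This integral is homotopy invariant, hence a homomorphism from the fundamental
group that kills commutators, which makes `J` independent of the path. It is also a singular
cocycle, hence a functional on first homology (`LocalPotential.period`). -/

theorem eq_of_isPreconnected_of_eventually_eq {Y Z : Type*} [TopologicalSpace Y] {f : Y → Z}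
    {S : Set Y} (hS : IsPreconnected S) (hf : ∀ x ∈ S, ∀ᶠ y in 𝓝 x, f y = f x) {x y : Y}
    (hx : x ∈ S) (hy : y ∈ S) : f x = f y := by
  have : PreconnectedSpace S := Subtype.preconnectedSpace hS
  have hc : IsLocallyConstant (fun s : S => f s) := by
    rw [IsLocallyConstant.iff_eventually_eq]
    exact fun s => continuous_subtype_val.continuousAt.eventually (hf s s.2)
  exact hc.apply_eq_of_isPreconnected isPreconnected_univ (x := ⟨x, hx⟩) (y := ⟨y, hy⟩)
    (mem_univ _) (mem_univ _)

/-- A compatible family of functions defined on the members of an open cover of `X`, any two of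
which differ by a locally constant function. -/
structure LocalPotential (X : Type*) [TopologicalSpace X] where
  /-- the domain of the potential around a point -/
  U : X → Set X
  /-- the potential around a point -/
  h : X → X → ℝ
  isOpen : ∀ x, IsOpen (U x)
  mem : ∀ x, x ∈ U x
  compat : ∀ i j x, x ∈ U i → x ∈ U j → ∀ᶠ y in 𝓝 x, h i y - h j y = h i x - h j x

namespace LocalPotential

variable {X Y Z : Type*} [TopologicalSpace X] [TopologicalSpace Y] [TopologicalSpace Z]
  (P : LocalPotential X)

/-- `F` is a primitive of the local potential along the map `φ`. -/
def IsPrimitive (φ : Y → X) (F : Y → ℝ) : Prop :=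
  ∀ y i, φ y ∈ P.U i → ∀ᶠ z in 𝓝 y, F z - F y = P.h i (φ z) - P.h i (φ y)

variable {P}

/-- Near a point any two potentials differ by a constant, so testing one of them there is enough. -/
theorem IsPrimitive.of_exists {φ : Y → X} (hφ : Continuous φ) {F : Y → ℝ}
    (H : ∀ y, ∃ i, φ y ∈ P.U i ∧ ∀ᶠ z in 𝓝 y, F z - F y = P.h i (φ z) - P.h i (φ y)) :
    P.IsPrimitive φ F := by
  intro y j hj
  obtain ⟨i, hi, h⟩ := H y
  filter_upwards [h, hφ.continuousAt.eventually (P.compat i j _ hi hj)] with z h1 h2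
  linarith

theorem IsPrimitive.comp {φ : Y → X} {F : Y → ℝ} (hF : P.IsPrimitive φ F) {α : Z → Y}
    (hα : Continuous α) : P.IsPrimitive (φ ∘ α) (F ∘ α) :=
  fun z i hi => hα.continuousAt.eventually (hF (α z) i hi)

theorem IsPrimitive.sub_eq_sub [PreconnectedSpace Y] {φ : Y → X} {F G : Y → ℝ}
    (hF : P.IsPrimitive φ F) (hG : P.IsPrimitive φ G) (y z : Y) : F z - F y = G z - G y := by
  have := eq_of_isPreconnected_of_eventually_eq (f := fun y => F y - G y)
    (isPreconnected_univ (α := Y)) (fun y _ => by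
      filter_upwards [hF y _ (P.mem _), hG y _ (P.mem _)] with z h1 h2
      linarith) (mem_univ y) (mem_univ z)
  linarith

theorem isPreconnected_ball_of_convex {E : Type*} [NormedAddCommGroup E] [NormedSpace ℝ E]
    {K : Set E} (hK : Convex ℝ K) (x : K) (r : ℝ) : IsPreconnected (Metric.ball x r) := by
  rw [← IsInducing.subtypeVal.isPreconnected_image]
  have : (Subtype.val '' Metric.ball x r : Set E) = K ∩ Metric.ball (x : E) r := by
    ext y
    simp [and_comm]
  rw [this]
  exact (hK.inter (convex_ball _ _)).isPreconnected

variable (P)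

/-- Cut the segment from `o` to `x` into pieces shorter than a Lebesgue number of the cover and add
up the increments of the local potentials. Convexity provides the segments and the connected balls
on which two potentials differ by a constant. It is used for the interval, the square and the
2-simplex. -/
theorem exists_isPrimitive {E : Type*} [NormedAddCommGroup E] [NormedSpace ℝ E]
    {K : Set E} (hK : Convex ℝ K) (hKc : IsCompact K) (o : K) (φ : C(K, X)) :
    ∃ F : K → ℝ, P.IsPrimitive φ F := by
  have : CompactSpace K := isCompact_iff_compactSpace.1 hKc
  obtain ⟨δ, hδ, hi⟩ := lebesgue_number_lemma_of_metric (isCompact_univ (X := K))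
    (fun x => (P.isOpen x).preimage φ.continuous)
    (fun s _ => mem_iUnion.2 ⟨φ s, P.mem (φ s)⟩)
  simp only [mem_univ, true_implies] at hi
  choose i hi using hi
  let c : K → K → ℝ := fun s t => P.h (i s) (φ t) - P.h (i s) (φ s)
  -- Cocycle identity for increments: the potentials chosen at `s` and `t` are both defined on the
  -- connected ball of radius `δ / 2` about `t`, so their difference is constant there.
  have hc (s t u : K) (hst : dist s t < δ / 2) (htu : dist t u < δ / 2) :
      c s t + c t u = c s u := by
    have := eq_of_isPreconnected_of_eventually_eq
      (f := fun z => P.h (i s) (φ z) - P.h (i t) (φ z))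
      (isPreconnected_ball_of_convex hK t (δ / 2)) (fun z hz => by
        refine φ.continuous.continuousAt.eventually (P.compat _ _ _ (hi s ?_) (hi t ?_))
        · have := dist_triangle_right z s t
          rw [Metric.mem_ball] at hz ⊢
          linarith
        · exact Metric.ball_subset_ball (by linarith) hz)
      (Metric.mem_ball_self (by linarith)) (y := u) (by rwa [Metric.mem_ball, dist_comm])
    simp only [c] at this ⊢
    linarith
  obtain ⟨D, hD⟩ := (Metric.isBounded_iff.1 hKc.isBounded)
  -- `N` pieces of a segment of length at most `|D|` are each shorter than `δ / 4`; the same `N`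
  -- serves all end points.
  obtain ⟨N, hN⟩ := exists_nat_gt (|D| / (δ / 4))
  have hN0 : (0 : ℝ) < N := lt_of_le_of_lt (by positivity) hN
  let τ : ℕ → I := fun k => projIcc (0 : ℝ) 1 zero_le_one (k / N)
  let q : K → ℕ → K := fun x k => ⟨AffineMap.lineMap (o : E) (x : E) (τ k : ℝ),
    hK.lineMap_mem o.2 x.2 (τ k).2⟩
  have hq0 (x : K) : q x 0 = o := Subtype.ext (by simp [q, τ])
  have hqN (x : K) : q x N = x := Subtype.ext (by simp [q, τ, hN0.ne'])
  have hq1 (x : K) (k : ℕ) : dist (q x k) (q x (k + 1)) < δ / 4 := by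
    have h1 : dist (τ k) (τ (k + 1)) ≤ 1 / N := by
      refine ((LipschitzWith.projIcc (zero_le_one' ℝ)).dist_le_mul _ _).trans (le_of_eq ?_)
      rw [NNReal.coe_one, one_mul, Real.dist_eq, abs_sub_comm, Nat.cast_succ, ← sub_div,
        add_sub_cancel_left, abs_of_nonneg (by positivity)]
    rw [Subtype.dist_eq, dist_lineMap_lineMap]
    calc dist (τ k : ℝ) (τ (k + 1) : ℝ) * dist (o : E) x ≤ 1 / N * |D| :=
          mul_le_mul h1 ((hD o.2 x.2).trans (le_abs_self D)) dist_nonneg (by positivity)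
      _ < δ / 4 := by
          rw [div_lt_iff₀ (by positivity)] at hN
          rw [one_div, inv_mul_lt_iff₀ hN0]
          exact hN
  have hq2 (x y : K) (k : ℕ) : dist (q x k) (q y k) ≤ dist x y := by
    rw [Subtype.dist_eq, Subtype.dist_eq]
    simp only [q, AffineMap.lineMap_apply, vsub_eq_sub, vadd_eq_add, dist_add_right]
    rw [dist_eq_norm, ← smul_sub, norm_smul, sub_sub_sub_cancel_right, ← dist_eq_norm]
    refine mul_le_of_le_one_left dist_nonneg ?_
    rw [Real.norm_of_nonneg (τ k).2.1]
    exact (τ k).2.2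
  refine ⟨fun x => ∑ k ∈ Finset.range N, c (q x k) (q x (k + 1)),
    .of_exists φ.continuous fun x => ⟨i x, hi x (Metric.mem_ball_self hδ), ?_⟩⟩
  filter_upwards [Metric.ball_mem_nhds x (show 0 < δ / 4 by positivity)] with y hy
  rw [Metric.mem_ball, dist_comm] at hy
  rw [← Finset.sum_sub_distrib]
  -- Both diagonal routes across the quadrilateral formed by consecutive points of the two segments
  -- give the same increment; the sum over `k` then telescopes.
  have step (k : ℕ) : c (q y k) (q y (k + 1)) - c (q x k) (q x (k + 1)) =
      c (q x (k + 1)) (q y (k + 1)) - c (q x k) (q y k) := by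
    have h1 := hc (q x k) (q y k) (q y (k + 1)) (by linarith [hq2 x y k])
      (by linarith [hq1 y k])
    have h2 := hc (q x k) (q x (k + 1)) (q y (k + 1)) (by linarith [hq1 x k])
      (by linarith [hq2 x y (k + 1)])
    linarith
  rw [Finset.sum_congr rfl fun k _ => step k,
    Finset.sum_range_sub (fun k => c (q x k) (q y k)), hq0, hq0, hqN, hqN]
  simp [c]

theorem exists_isPrimitive_curve (γ : C(I, X)) : ∃ F : I → ℝ, P.IsPrimitive γ F :=
  P.exists_isPrimitive (convex_Icc 0 1) isCompact_Icc 0 γ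

/-- The integral of a local potential along a continuous curve. -/
def integral (γ : C(I, X)) : ℝ :=
  (P.exists_isPrimitive_curve γ).choose 1 - (P.exists_isPrimitive_curve γ).choose 0

variable {P}

theorem IsPrimitive.integral_eq {γ : C(I, X)} {F : I → ℝ} (hF : P.IsPrimitive γ F) :
    P.integral γ = F 1 - F 0 :=
  (P.exists_isPrimitive_curve γ).choose_spec.sub_eq_sub hF 0 1

theorem IsPrimitive.integral_comp {φ : C(Y, X)} {F : Y → ℝ} (hF : P.IsPrimitive φ F)
    (α : C(I, Y)) : P.integral (φ.comp α) = F (α 1) - F (α 0) :=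
  IsPrimitive.integral_eq (γ := φ.comp α) (hF.comp α.continuous)

variable (P)

theorem exists_isPrimitive_square (H : C(I × I, X)) : ∃ F : I × I → ℝ, P.IsPrimitive H F := by
  -- The square is identified with an order interval of `ℝ × ℝ`, which is a convex set of a normed
  -- space.
  let r : C(Icc (0 : ℝ × ℝ) 1, I × I) :=
    ⟨fun z => (⟨z.1.1, z.2.1.1, z.2.2.1⟩, ⟨z.1.2, z.2.1.2, z.2.2.2⟩), by fun_prop⟩
  let s : C(I × I, Icc (0 : ℝ × ℝ) 1) :=
    ⟨fun z => ⟨(z.1, z.2), ⟨z.1.2.1, z.2.2.1⟩, ⟨z.1.2.2, z.2.2.2⟩⟩, by fun_prop⟩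
  obtain ⟨F, hF⟩ := P.exists_isPrimitive (convex_Icc (0 : ℝ × ℝ) 1) isCompact_Icc
    ⟨0, le_rfl, zero_le_one⟩ (H.comp r)
  exact ⟨F ∘ s, hF.comp s.continuous⟩

/-- Take a primitive over the whole square. The homotopy is constant on the two sides where the end
points stay fixed, so the primitive takes equal values at the ends of each such side. -/
theorem integral_eq_of_homotopic {x y : X} {γ γ' : Path x y} (h : γ.Homotopic γ') :
    P.integral γ = P.integral γ' := by
  obtain ⟨H⟩ := h
  obtain ⟨F, hF⟩ := P.exists_isPrimitive_square H.toContinuousMap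
  have row (s : I) : P.integral (H.eval s) = F (s, 1) - F (s, 0) :=
    hF.integral_comp ⟨fun t => (s, t), by fun_prop⟩
  have const (t : I) (ht : t = 0 ∨ t = 1) : F (1, t) - F (0, t) = 0 := by
    have h1 := hF.integral_comp ⟨fun s => (s, t), by fun_prop⟩
    have h2 : P.IsPrimitive (H.toContinuousMap.comp ⟨fun s => (s, t), by fun_prop⟩)
        (fun _ : I => 0) := by
      intro s i hi
      refine Eventually.of_forall fun s' => ?_
      have : H (s', t) = H (s, t) := by rcases ht with rfl | rfl <;> simp
      simp only [ContinuousMap.comp_apply, ContinuousMap.coe_mk]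
      rw [show H.toContinuousMap (s', t) = H.toContinuousMap (s, t) from this]
      simp
    rw [h2.integral_eq] at h1
    simpa using h1.symm
  have h0 := row 0
  have h1 := row 1
  rw [H.eval_zero] at h0
  rw [H.eval_one] at h1
  rw [h0, h1]
  linarith [const 0 (.inl rfl), const 1 (.inr rfl)]

theorem integral_trans {x y z : X} (γ : Path x y) (γ' : Path y z) :
    P.integral (γ.trans γ') = P.integral γ + P.integral γ' := by
  obtain ⟨F, hF⟩ := P.exists_isPrimitive_curve (γ.trans γ')
  have h1 := hF.integral_comp ⟨fun t : I => ⟨t / 2, by constructor <;> linarith [t.2.1, t.2.2]⟩,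
    by fun_prop⟩
  have h2 := hF.integral_comp ⟨fun t : I => ⟨(t + 1) / 2, by
    constructor <;> linarith [t.2.1, t.2.2]⟩, by fun_prop⟩
  have e1 : ((γ.trans γ' : Path x z) : C(I, X)).comp ⟨fun t : I => ⟨t / 2, by
      constructor <;> linarith [t.2.1, t.2.2]⟩, by fun_prop⟩ = γ := by
    ext t
    have : (t : ℝ) / 2 ≤ 2⁻¹ := by linarith [t.2.2]
    simp only [ContinuousMap.comp_apply, ContinuousMap.coe_mk]
    rw [Path.trans_apply, dif_pos (by simpa using this)]
    simp [mul_div_cancel₀]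
  have e2 : ((γ.trans γ' : Path x z) : C(I, X)).comp ⟨fun t : I => ⟨(t + 1) / 2, by
      constructor <;> linarith [t.2.1, t.2.2]⟩, by fun_prop⟩ = γ' := by
    ext t
    rcases eq_or_ne t 0 with rfl | ht
    -- The midpoint belongs to the first branch of the concatenation, so here the value is the
    -- common end point `y`.
    · simp [Path.trans_apply]
    · have : ¬ ((t : ℝ) + 1) / 2 ≤ 2⁻¹ := by
        have := unitInterval.pos_iff_ne_zero.2 ht
        have : (0 : ℝ) < t := this
        linarith
      simp only [ContinuousMap.comp_apply, ContinuousMap.coe_mk]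
      rw [Path.trans_apply, dif_neg (by simpa using this)]
      simp [mul_div_cancel₀]
  rw [e1] at h1
  rw [e2] at h2
  rw [h1, h2, hF.integral_eq]
  have a1 : (⟨((1 : I) : ℝ) / 2, by norm_num⟩ : I) = ⟨(((0 : I) : ℝ) + 1) / 2, by norm_num⟩ :=
    Subtype.ext (by simp)
  have a2 : (⟨((0 : I) : ℝ) / 2, by norm_num⟩ : I) = 0 := Subtype.ext (by simp)
  have a3 : (⟨(((1 : I) : ℝ) + 1) / 2, by norm_num⟩ : I) = 1 := Subtype.ext (by simp)
  simp only [ContinuousMap.coe_mk]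
  rw [a1, a2, a3]
  ring

theorem integral_symm {x y : X} (γ : Path x y) : P.integral γ.symm = -P.integral γ := by
  obtain ⟨F, hF⟩ := P.exists_isPrimitive_curve γ
  have h1 := hF.integral_comp ⟨unitInterval.symm, by fun_prop⟩
  have : ((γ : C(I, X)).comp ⟨unitInterval.symm, by fun_prop⟩) = γ.symm := by ext; simp
  rw [this] at h1
  rw [h1, hF.integral_eq]
  simp

/-- Integration of a local potential, as a homomorphism on the fundamental group. -/
def fundamentalGroupHom (x : X) : FundamentalGroup X x →* Multiplicative ℝ where
  toFun := Quotient.lift (fun γ : Path x x => Multiplicative.ofAdd (P.integral γ))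
    fun _ _ h => congrArg _ (P.integral_eq_of_homotopic h)
  map_one' := by
    have h : P.integral ((Path.refl x : Path x x) : C(I, X)) = 0 := by
      have := P.integral_trans (Path.refl x) (Path.refl x)
      rw [Path.refl_trans_refl] at this
      linarith
    exact congrArg Multiplicative.ofAdd h
  map_mul' a b := by
    induction a using Path.Homotopic.Quotient.ind with | _ a
    induction b using Path.Homotopic.Quotient.ind with | _ b
    -- The product `a * b` unfolds to the concatenation of `b` followed by `a`, whence the
    -- commutation.
    exact congrArg Multiplicative.ofAdd ((P.integral_trans b a).trans (add_comm _ _))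

/-- The loop `γ` followed by the reverse of `γ'` projects into the commutator subgroup, which any
homomorphism to an abelian group kills. -/
theorem integral_eq_of_range_le {p : C(Y, X)} {x y : Y} (γ γ' : Path x y)
    (hp : (FundamentalGroup.map p x).range ≤ commutator (FundamentalGroup X (p x))) :
    P.integral (γ.map p.continuous) = P.integral (γ'.map p.continuous) := by
  have h1 := Abelianization.commutator_subset_ker (P.fundamentalGroupHom (p x))
    (hp ⟨FundamentalGroup.fromPath (Path.Homotopic.Quotient.mk (γ.trans γ'.symm)), rfl⟩)
  have h2 : P.integral ((γ.trans γ'.symm).map p.continuous) = 0 := congrArg Multiplicative.toAdd h1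
  rw [Path.map_trans, ← Path.map_symm, P.integral_trans, P.integral_symm] at h2
  linarith

end LocalPotential

/-! ### The pairing of a local potential with first homology -/

section Homology

open CategoryTheory AlgebraicTopology

variable {X Y : Type u} [TopologicalSpace X] [TopologicalSpace Y]

/-- The curve underlying a singular `1`-simplex. -/
def simplexCurve (x : (TopCat.toSSet.obj (TopCat.of X)) _⦋1⦌) : C(I, X) :=
  ((TopCat.of X).toSSetObjEquiv _ x).comp
    ⟨stdSimplexHomeomorphUnitInterval.symm, stdSimplexHomeomorphUnitInterval.symm.continuous⟩

theorem simplexCurve_curveSimplex (γ : C(I, X)) : simplexCurve (curveSimplex γ) = γ := by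
  ext t
  simp [simplexCurve, curveSimplex]

theorem curveSimplex_simplexCurve (x : (TopCat.toSSet.obj (TopCat.of X)) _⦋1⦌) :
    curveSimplex (simplexCurve x) = x := by
  apply ((TopCat.of X).toSSetObjEquiv _).injective
  ext t
  simp [simplexCurve, curveSimplex]

/-- The edge opposite to the vertex `i` of the standard `2`-simplex. -/
def stdEdge (i : Fin 3) : C(I, stdSimplex ℝ (Fin 3)) :=
  ⟨fun t => stdSimplex.map i.succAbove (stdSimplexHomeomorphUnitInterval.symm t),
    (stdSimplex.continuous_map _).comp stdSimplexHomeomorphUnitInterval.symm.continuous⟩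

theorem stdEdge_zero (i : Fin 3) : stdEdge i 0 = stdSimplex.vertex (i.succAbove 0) := by
  rw [← stdSimplex.map_vertex]
  refine congrArg (stdSimplex.map _) ?_
  rw [Homeomorph.symm_apply_eq, stdSimplexHomeomorphUnitInterval_zero]

theorem stdEdge_one (i : Fin 3) : stdEdge i 1 = stdSimplex.vertex (i.succAbove 1) := by
  rw [← stdSimplex.map_vertex]
  refine congrArg (stdSimplex.map _) ?_
  rw [Homeomorph.symm_apply_eq, stdSimplexHomeomorphUnitInterval_one]

theorem stdEdge_apply (i : Fin 3) (t : I) (j : Fin 3) : (stdEdge i t).1 j =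
    (if i.succAbove 0 = j then 1 - (t : ℝ) else 0) + if i.succAbove 1 = j then (t : ℝ) else 0 := by
  change FunOnFinite.linearMap ℝ ℝ i.succAbove
    (stdSimplexHomeomorphUnitInterval.symm t : Fin 2 → ℝ) j = _
  rw [FunOnFinite.linearMap_apply_apply, Finset.sum_filter, Fin.sum_univ_two]
  rfl

theorem simplexCurve_δ (x : (TopCat.toSSet.obj (TopCat.of X)) _⦋2⦌) (i : Fin 3) :
    simplexCurve ((TopCat.toSSet.obj (TopCat.of X)).δ i x) =
      ((TopCat.of X).toSSetObjEquiv _ x).comp (stdEdge i) :=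
  rfl

/-- The functional on singular `1`-chains given by integration of a local potential. -/
def LocalPotential.chainMap (P : LocalPotential X) :
    ((TopCat.toSSet.obj (TopCat.of X)).chainComplex coeffZ.{u}).X 1 ⟶
      ModuleCat.of ℤ (ULift.{u} ℝ) :=
  Limits.Cofan.IsColimit.desc
    ((TopCat.toSSet.obj (TopCat.of X)).isColimitChainComplexXCofan coeffZ.{u} 1) fun x =>
      ModuleCat.ofHom (ULift.moduleEquiv.symm.toLinearMap ∘ₗ
        LinearMap.toSpanSingleton ℤ ℝ (P.integral (simplexCurve x)) ∘ₗ
          ULift.moduleEquiv.toLinearMap)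

theorem LocalPotential.ι_chainMap (P : LocalPotential X)
    (x : (TopCat.toSSet.obj (TopCat.of X)) _⦋1⦌) :
    (TopCat.toSSet.obj (TopCat.of X)).ιChainComplex x ≫ P.chainMap =
      ModuleCat.ofHom (ULift.moduleEquiv.symm.toLinearMap ∘ₗ
        LinearMap.toSpanSingleton ℤ ℝ (P.integral (simplexCurve x)) ∘ₗ
          ULift.moduleEquiv.toLinearMap) :=
  Limits.Cofan.IsColimit.fac _ _ x

/-- A primitive over the whole 2-simplex turns the edge integrals into differences of vertex values,
which cancel. This is the cocycle condition. -/
theorem LocalPotential.integral_δ (P : LocalPotential X)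
    (x : (TopCat.toSSet.obj (TopCat.of X)) _⦋2⦌) :
    P.integral (simplexCurve ((TopCat.toSSet.obj (TopCat.of X)).δ 0 x)) -
      P.integral (simplexCurve ((TopCat.toSSet.obj (TopCat.of X)).δ 1 x)) +
      P.integral (simplexCurve ((TopCat.toSSet.obj (TopCat.of X)).δ 2 x)) = 0 := by
  obtain ⟨F, hF⟩ := P.exists_isPrimitive (convex_stdSimplex ℝ (Fin 3))
    (isCompact_stdSimplex ℝ (Fin 3)) (stdSimplex.vertex 0) ((TopCat.of X).toSSetObjEquiv _ x)
  simp only [simplexCurve_δ]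
  rw [hF.integral_comp, hF.integral_comp, hF.integral_comp]
  simp only [stdEdge_zero, stdEdge_one]
  have e0 : (0 : Fin 3).succAbove (0 : Fin 2) = 1 := rfl
  have e1 : (0 : Fin 3).succAbove (1 : Fin 2) = 2 := rfl
  have e2 : (1 : Fin 3).succAbove (0 : Fin 2) = 0 := rfl
  have e3 : (1 : Fin 3).succAbove (1 : Fin 2) = 2 := rfl
  have e4 : (2 : Fin 3).succAbove (0 : Fin 2) = 0 := rfl
  have e5 : (2 : Fin 3).succAbove (1 : Fin 2) = 1 := rfl
  rw [e0, e1, e2, e3, e4, e5]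
  ring

theorem LocalPotential.d_chainMap (P : LocalPotential X) :
    ((TopCat.toSSet.obj (TopCat.of X)).chainComplex coeffZ.{u}).d 2 1 ≫ P.chainMap = 0 := by
  refine SSet.chainComplex_hom_ext fun x => ?_
  rw [SSet.ιChainComplex_d_assoc, Preadditive.sum_comp, Fin.sum_univ_three]
  simp only [Preadditive.zsmul_comp, P.ι_chainMap, Limits.comp_zero]
  ext m
  have := P.integral_δ x
  simp
  linear_combination (m.down : ℝ) * this

/-- The pairing of first homology with a local potential. -/
def LocalPotential.period (P : LocalPotential X) : H1 X →ₗ[ℤ] ℝ :=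
  ULift.moduleEquiv.toLinearMap ∘ₗ
    (((TopCat.toSSet.obj (TopCat.of X)).chainComplex coeffZ.{u}).homologyι 1 ≫
      ((TopCat.toSSet.obj (TopCat.of X)).chainComplex coeffZ.{u}).descOpcycles P.chainMap 2
        (by simp) P.d_chainMap).hom

/-- Going from cycles through homology to opcycles is inclusion into chains followed by projection,
so the period is the chain functional evaluated on a single simplex. -/
theorem LocalPotential.period_loopClass (P : LocalPotential X) (γ : C(I, X)) (h : γ 0 = γ 1) :
    P.period (loopClass γ h) = P.integral γ := by
  have key : (((TopCat.toSSet.obj (TopCat.of X)).chainComplex coeffZ.{u}).liftCycles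
      ((TopCat.toSSet.obj (TopCat.of X)).ιChainComplex (curveSimplex γ)) 0 (by simp)
      (curveSimplex_d γ h) ≫
    ((TopCat.toSSet.obj (TopCat.of X)).chainComplex coeffZ.{u}).homologyπ 1) ≫
      (((TopCat.toSSet.obj (TopCat.of X)).chainComplex coeffZ.{u}).homologyι 1 ≫
      ((TopCat.toSSet.obj (TopCat.of X)).chainComplex coeffZ.{u}).descOpcycles P.chainMap 2
        (by simp) P.d_chainMap) =
      ModuleCat.ofHom (ULift.moduleEquiv.symm.toLinearMap ∘ₗ
        LinearMap.toSpanSingleton ℤ ℝ (P.integral (simplexCurve (curveSimplex γ))) ∘ₗ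
          ULift.moduleEquiv.toLinearMap) := by
    rw [← P.ι_chainMap, Category.assoc, HomologicalComplex.homology_π_ι_assoc,
      HomologicalComplex.p_descOpcycles, HomologicalComplex.liftCycles_i_assoc]
  have := congrArg (fun φ => (φ.hom (ULift.up 1)).down) key
  rw [simplexCurve_curveSimplex] at this
  refine Eq.trans this ?_
  simp

theorem H1map_loopClass (f : C(X, Y)) (γ : C(I, X)) (h : γ 0 = γ 1) :
    H1map f (loopClass γ h) = loopClass (f.comp γ) (by simp [h]) := by
  have key : (((TopCat.toSSet.obj (TopCat.of X)).chainComplex coeffZ.{u}).liftCycles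
      ((TopCat.toSSet.obj (TopCat.of X)).ιChainComplex (curveSimplex γ)) 0 (by simp)
      (curveSimplex_d γ h) ≫
    ((TopCat.toSSet.obj (TopCat.of X)).chainComplex coeffZ.{u}).homologyπ 1) ≫
      HomologicalComplex.homologyMap
        (SSet.chainComplexMap (TopCat.toSSet.map (TopCat.ofHom f)) coeffZ.{u}) 1 =
      ((TopCat.toSSet.obj (TopCat.of Y)).chainComplex coeffZ.{u}).liftCycles
      ((TopCat.toSSet.obj (TopCat.of Y)).ιChainComplex (curveSimplex (f.comp γ))) 0 (by simp)
      (curveSimplex_d (f.comp γ) (by simp [h])) ≫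
    ((TopCat.toSSet.obj (TopCat.of Y)).chainComplex coeffZ.{u}).homologyπ 1 := by
    rw [Category.assoc, HomologicalComplex.homologyπ_naturality,
      HomologicalComplex.liftCycles_comp_cyclesMap_assoc]
    congr 2
    rw [SSet.ι_chainComplexMap_f]
    rfl
  exact congrArg (fun φ => φ.hom (ULift.up 1)) key

/-- If three loops are the faces of a singular `2`-simplex, then the alternating sum of their
homology classes vanishes. -/
theorem loopClass_face_relation (s : C(stdSimplex ℝ (Fin 3), X))
    (h : ∀ i, s.comp (stdEdge i) 0 = s.comp (stdEdge i) 1) :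
    loopClass (s.comp (stdEdge 0)) (h 0) - loopClass (s.comp (stdEdge 1)) (h 1) +
      loopClass (s.comp (stdEdge 2)) (h 2) = 0 := by
  let K := (TopCat.toSSet.obj (TopCat.of X)).chainComplex coeffZ.{u}
  let x : (TopCat.toSSet.obj (TopCat.of X)) _⦋2⦌ := ((TopCat.of X).toSSetObjEquiv _).symm s
  have hx (i : Fin 3) : curveSimplex (s.comp (stdEdge i)) =
      (TopCat.toSSet.obj (TopCat.of X)).δ i x := by
    rw [← curveSimplex_simplexCurve ((TopCat.toSSet.obj (TopCat.of X)).δ i x), simplexCurve_δ]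
    simp [x]
  let z (i : Fin 3) := K.liftCycles
      ((TopCat.toSSet.obj (TopCat.of X)).ιChainComplex (curveSimplex (s.comp (stdEdge i)))) 0
      (by simp) (curveSimplex_d _ (h i))
  have key : (z 0 - z 1 + z 2) ≫ K.homologyπ 1 = 0 := by
    have : z 0 - z 1 + z 2 =
        (TopCat.toSSet.obj (TopCat.of X)).ιChainComplex x ≫ K.toCycles 2 1 := by
      rw [← cancel_mono (K.iCycles 1)]
      simp only [z, Preadditive.add_comp, Preadditive.sub_comp, HomologicalComplex.liftCycles_i,
        Category.assoc, HomologicalComplex.toCycles_i, hx]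
      rw [SSet.ιChainComplex_d, Fin.sum_univ_three]
      simp [sub_eq_add_neg]
    rw [this, Category.assoc, HomologicalComplex.toCycles_comp_homologyπ, Limits.comp_zero]
  rw [Preadditive.add_comp, Preadditive.sub_comp] at key
  exact congrArg (fun φ => φ.hom (ULift.up 1)) key

/-- For a constant 2-simplex the face relation reads `c - c + c = 0`. -/
theorem loopClass_const (x : X) : loopClass (ContinuousMap.const I x) rfl = 0 := by
  have := loopClass_face_relation (ContinuousMap.const _ x) fun _ => rfl
  simpa using this

/-- The 2-simplex `z ↦ γ (z 1)` depends on one barycentric coordinate only; its faces are the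
reversed loop, a constant loop and `γ`. -/
theorem loopClass_symm {x : X} (γ : Path x x) :
    loopClass (γ.symm : C(I, X)) (by simp) = -loopClass (γ : C(I, X)) (by simp) := by
  let s : C(stdSimplex ℝ (Fin 3), X) :=
    ⟨fun z => γ ⟨z.1 1, z.2.1 1, stdSimplex.le_one z 1⟩, γ.continuous.comp
      (((continuous_apply 1).comp continuous_subtype_val).subtype_mk _)⟩
  have e0 : s.comp (stdEdge 0) = γ.symm := by
    ext t
    simp only [s, ContinuousMap.comp_apply, ContinuousMap.coe_mk, stdEdge_apply]
    have e0 : (0 : Fin 3).succAbove (0 : Fin 2) = 1 := rfl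
    have e1 : (0 : Fin 3).succAbove (1 : Fin 2) = 2 := rfl
    simp [e0, e1]
    rfl
  have e1 : s.comp (stdEdge 1) = ContinuousMap.const I x := by
    ext t
    simp only [s, ContinuousMap.comp_apply, ContinuousMap.coe_mk, stdEdge_apply]
    have e0 : (1 : Fin 3).succAbove (0 : Fin 2) = 0 := rfl
    have e1 : (1 : Fin 3).succAbove (1 : Fin 2) = 2 := rfl
    simp [e0, e1]
  have e2 : s.comp (stdEdge 2) = γ := by
    ext t
    simp only [s, ContinuousMap.comp_apply, ContinuousMap.coe_mk, stdEdge_apply]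
    have e0 : (2 : Fin 3).succAbove (0 : Fin 2) = 0 := rfl
    have e1 : (2 : Fin 3).succAbove (1 : Fin 2) = 1 := rfl
    simp [e0, e1]
  have := loopClass_face_relation s (by
    intro i
    fin_cases i
    · simp [e0]
    · simp [e1]
    · simp [e2])
  simp only [e0, e1, e2, loopClass_const] at this
  rw [sub_zero] at this
  exact eq_neg_of_add_eq_zero_left this

end Homology

/-! ### Closed one-forms as local potentials -/

section Forms

variable {n : ℕ} {M : Type u} [TopologicalSpace M] [ChartedSpace (EuclideanSpace ℝ (Fin n)) M]
  [IsManifold (𝓡 n) ∞ M]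

theorem chartRep_comp_mfderiv (η : (x : M) → TangentSpace (𝓡 n) x →L[ℝ] ℝ) (x₀ : M) {y : M}
    (hy : y ∈ (extChartAt (𝓡 n) x₀).source) :
    (chartRep η x₀ (extChartAt (𝓡 n) x₀ y)).comp
      (mfderiv (𝓡 n) 𝓘(ℝ, EuclideanSpace ℝ (Fin n)) (extChartAt (𝓡 n) x₀) y) = η y := by
  have h := mfderivWithin_extChartAt_symm_comp_mfderiv_extChartAt' hy
  rw [ModelWithCorners.range_eq_univ, mfderivWithin_univ] at h
  have e : (extChartAt (𝓡 n) x₀).symm (extChartAt (𝓡 n) x₀ y) = y :=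
    (extChartAt (𝓡 n) x₀).left_inv hy
  -- The base points are equal but not definitionally so; both covectors are compared as functionals
  -- on the model space.
  have e' : (show EuclideanSpace ℝ (Fin n) →L[ℝ] ℝ from
      η ((extChartAt (𝓡 n) x₀).symm (extChartAt (𝓡 n) x₀ y))) = η y :=
    congrArg (fun z => (show EuclideanSpace ℝ (Fin n) →L[ℝ] ℝ from η z)) e
  unfold chartRep
  refine (ContinuousLinearMap.comp_assoc _ _ _).trans ?_
  ext v
  have h2 := congrArg (fun L : EuclideanSpace ℝ (Fin n) →L[ℝ] EuclideanSpace ℝ (Fin n) => L v) h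
  have h3 := congrArg (fun L : EuclideanSpace ℝ (Fin n) →L[ℝ] ℝ => L v) e'
  exact (congrArg _ h2).trans h3

/-- Poincaré lemma on a ball inside the chart target, pulled back by the chart. The `C¹` regularity
is kept for the fundamental theorem of calculus along smooth paths. -/
theorem ClosedOneForm.exists_hasMFDerivAt (η : ClosedOneForm n M) (x₀ : M) :
    ∃ (U : Set M) (h : M → ℝ), IsOpen U ∧ x₀ ∈ U ∧ ∀ y ∈ U,
      HasMFDerivAt (𝓡 n) 𝓘(ℝ, ℝ) h y (η.toFun y) ∧ ContMDiffAt (𝓡 n) 𝓘(ℝ, ℝ) 1 h y := by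
  obtain ⟨r, hr, hB⟩ := Metric.isOpen_iff.1
    (isOpen_extChartAt_target x₀ : IsOpen (extChartAt (𝓡 n) x₀).target) _
    (mem_extChartAt_target x₀)
  have hs := (η.smooth x₀).mono hB
  obtain ⟨H, hH⟩ := (convex_ball (extChartAt (𝓡 n) x₀ x₀)
    r).exists_forall_hasFDerivAt_of_fderiv_symmetric Metric.isOpen_ball
    (hs.differentiableOn (by simp)) fun y hy => η.closed x₀ y (hB hy)
  have hH1 : ContDiffOn ℝ 1 H (Metric.ball (extChartAt (𝓡 n) x₀ x₀) r) := by
    rw [← zero_add 1, contDiffOn_succ_iff_fderiv_of_isOpen Metric.isOpen_ball, contDiffOn_zero]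
    exact ⟨fun y hy => (hH y hy).differentiableAt.differentiableWithinAt, by simp,
      hs.continuousOn.congr fun y hy => (hH y hy).fderiv⟩
  refine ⟨(extChartAt (𝓡 n) x₀).source ∩ extChartAt (𝓡 n) x₀ ⁻¹'
    Metric.ball (extChartAt (𝓡 n) x₀ x₀) r, H ∘ extChartAt (𝓡 n) x₀,
    (continuousOn_extChartAt x₀).isOpen_inter_preimage (isOpen_extChartAt_source x₀)
      Metric.isOpen_ball, ⟨mem_extChartAt_source x₀, Metric.mem_ball_self hr⟩, ?_⟩
  rintro y ⟨hy, hyB⟩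
  have hy' : y ∈ (chartAt (EuclideanSpace ℝ (Fin n)) x₀).source := by rwa [extChartAt_source] at hy
  constructor
  · have h1 := (hH _ hyB).hasMFDerivAt.comp y
      (mdifferentiableAt_extChartAt hy').hasMFDerivAt
    have h2 := chartRep_comp_mfderiv η.toFun x₀ hy
    rw [← h2]
    exact h1
  · exact (hH1.contDiffAt (Metric.isOpen_ball.mem_nhds hyB)).contMDiffAt.comp y
      (contMDiffAt_extChartAt' hy')

/-- A function with vanishing derivative near a point is constant near that point. -/
theorem eventually_eq_of_hasMFDerivAt_zero {h : M → ℝ} {x : M}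
    (hh : ∀ᶠ y in 𝓝 x, HasMFDerivAt (𝓡 n) 𝓘(ℝ, ℝ) h y 0) : ∀ᶠ y in 𝓝 x, h y = h x := by
  have hsymm : Tendsto (extChartAt (𝓡 n) x).symm (𝓝 (extChartAt (𝓡 n) x x)) (𝓝 x) := by
    have : ContinuousAt (extChartAt (𝓡 n) x).symm _ := continuousAt_extChartAt_symm x
    rwa [ContinuousAt, extChartAt_to_inv] at this
  obtain ⟨r, hr, hB⟩ := Metric.eventually_nhds_iff_ball.1 ((hsymm.eventually hh).and
    (extChartAt_target_mem_nhds x))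
  have hd (z) (hz : z ∈ Metric.ball (extChartAt (𝓡 n) x x) r) :
      HasFDerivAt (𝕜 := ℝ) (h ∘ (extChartAt (𝓡 n) x).symm) 0 z := by
    have h1 : MDifferentiableWithinAt 𝓘(ℝ, EuclideanSpace ℝ (Fin n)) (𝓡 n)
        (extChartAt (𝓡 n) x).symm (range (𝓡 n)) z :=
      mdifferentiableWithinAt_extChartAt_symm (hB z hz).2
    rw [ModelWithCorners.range_eq_univ, mdifferentiableWithinAt_univ] at h1
    have h2 : HasMFDerivAt 𝓘(ℝ, EuclideanSpace ℝ (Fin n)) 𝓘(ℝ, ℝ)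
        (h ∘ (extChartAt (𝓡 n) x).symm) z 0 := by
      refine ((hB z hz).1.comp z h1.hasMFDerivAt).congr_mfderiv ?_
      ext v
      rfl
    exact h2.hasFDerivAt
  filter_upwards [(continuousAt_extChartAt x : ContinuousAt (extChartAt (𝓡 n) x) x).eventually
      (Metric.ball_mem_nhds _ hr),
    (extChartAt_source_mem_nhds x : (extChartAt (𝓡 n) x).source ∈ _)] with y hy hy'
  have := (convex_ball (extChartAt (𝓡 n) x x) r).is_const_of_fderivWithin_eq_zero (𝕜 := ℝ)
    (fun z hz => (hd z hz).differentiableAt.differentiableWithinAt)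
    (fun z hz => by
      rw [fderivWithin_of_isOpen Metric.isOpen_ball hz]
      exact (hd z hz).fderiv) hy (Metric.mem_ball_self hr)
  rwa [Function.comp_apply, Function.comp_apply, (extChartAt (𝓡 n) x).left_inv hy',
    extChartAt_to_inv] at this

/-- The local primitives of a closed one-form. -/
def ClosedOneForm.potential (η : ClosedOneForm n M) : LocalPotential M where
  U x := (η.exists_hasMFDerivAt x).choose
  h x := (η.exists_hasMFDerivAt x).choose_spec.choose
  isOpen x := (η.exists_hasMFDerivAt x).choose_spec.choose_spec.1
  mem x := (η.exists_hasMFDerivAt x).choose_spec.choose_spec.2.1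
  compat i j x hi hj := by
    have Hi := (η.exists_hasMFDerivAt i).choose_spec.choose_spec
    have Hj := (η.exists_hasMFDerivAt j).choose_spec.choose_spec
    refine eventually_eq_of_hasMFDerivAt_zero (n := n) (x := x)
      (h := fun y => (η.exists_hasMFDerivAt i).choose_spec.choose y -
        (η.exists_hasMFDerivAt j).choose_spec.choose y) ?_
    filter_upwards [Hi.1.mem_nhds hi, Hj.1.mem_nhds hj] with y hyi hyj
    have := (Hi.2.2 y hyi).1.sub (Hj.2.2 y hyj).1
    rwa [sub_self] at this

theorem ClosedOneForm.hasMFDerivAt_potential (η : ClosedOneForm n M) {x y : M}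
    (hy : y ∈ η.potential.U x) : HasMFDerivAt (𝓡 n) 𝓘(ℝ, ℝ) (η.potential.h x) y (η.toFun y) :=
  ((η.exists_hasMFDerivAt x).choose_spec.choose_spec.2.2 y hy).1

theorem ClosedOneForm.contMDiffAt_potential (η : ClosedOneForm n M) {x y : M}
    (hy : y ∈ η.potential.U x) : ContMDiffAt (𝓡 n) 𝓘(ℝ, ℝ) 1 (η.potential.h x) y :=
  ((η.exists_hasMFDerivAt x).choose_spec.choose_spec.2.2 y hy).2

/-- Locally on `[0,1]` a primitive is a constant plus a local potential composed with `γ`. The chain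
rule makes the integrand its derivative, and the fundamental theorem of calculus concludes. -/
theorem ClosedOneForm.pathIntegral_eq (η : ClosedOneForm n M) {a b : M} {γ : Path a b}
    (hγ : IsSmoothPath n γ) : η.pathIntegral γ = η.potential.integral γ := by
  obtain ⟨F, hF⟩ := η.potential.exists_isPrimitive_curve γ
  rw [hF.integral_eq]
  set G : ℝ → ℝ := IccExtend zero_le_one F with hG
  have hloc (t : ℝ) (ht : t ∈ Icc (0 : ℝ) 1) : ∃ i, γ.extend t ∈ η.potential.U i ∧
      G =ᶠ[𝓝[Icc 0 1] t] fun s => (G t - η.potential.h i (γ.extend t)) +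
        η.potential.h i (γ.extend s) := by
    refine ⟨γ.extend t, η.potential.mem _, ?_⟩
    have h1 := hF ⟨t, ht⟩ (γ.extend t) (by
      rw [γ.extend_apply ht]
      exact η.potential.mem _)
    rw [nhds_subtype_eq_comap, eventually_comap] at h1
    filter_upwards [mem_nhdsWithin_of_mem_nhds h1, self_mem_nhdsWithin] with s hs hsI
    have := hs ⟨s, hsI⟩ rfl
    simp only [hG, IccExtend_of_mem _ _ ht, IccExtend_of_mem _ _ hsI, γ.extend_apply hsI,
      γ.extend_apply ht] at this ⊢
    change _ = η.potential.h _ (γ _) - η.potential.h _ (γ _) at this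
    linarith
  have hder (t : ℝ) (ht : t ∈ Icc (0 : ℝ) 1) : derivWithin G (Icc 0 1) t =
      η.toFun (γ.extend t) (mfderivWithin 𝓘(ℝ, ℝ) (𝓡 n) γ.extend (Icc (0 : ℝ) 1) t (1 : ℝ)) := by
    obtain ⟨i, hi, he⟩ := hloc t ht
    have h1 := (η.hasMFDerivAt_potential hi).comp_hasMFDerivWithinAt t
      ((hγ t ht).mdifferentiableWithinAt (by simp)).hasMFDerivWithinAt
    have h2 := ((h1.hasFDerivWithinAt.const_add
      (G t - η.potential.h i (γ.extend t))).congr_of_eventuallyEq he (by simp)).hasDerivWithinAt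
    exact h2.derivWithin (uniqueDiffOn_Icc zero_lt_one t ht)
  have hC : ContDiffOn ℝ 1 G (Icc 0 1) := by
    intro t ht
    obtain ⟨i, hi, he⟩ := hloc t ht
    have h1 : ContMDiffWithinAt 𝓘(ℝ, ℝ) 𝓘(ℝ, ℝ) 1 (η.potential.h i ∘ γ.extend) (Icc 0 1) t :=
      (η.contMDiffAt_potential hi).comp_contMDiffWithinAt t ((hγ t ht).of_le (by simp))
    exact (contDiffWithinAt_const.add h1.contDiffWithinAt).congr_of_eventuallyEq he (by simp)
  have h01 := intervalIntegral.integral_derivWithin_Icc_of_contDiffOn_Icc hC zero_le_one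
  unfold ClosedOneForm.pathIntegral
  rw [← intervalIntegral.integral_congr (fun t ht => hder t (by rwa [uIcc_of_le zero_le_one] at ht)),
    h01]
  simp [hG]

theorem IsDualTo.period_potential {b : ℕ} {η : Fin b → ClosedOneForm n M}
    {Γ : Module.Basis (Fin b) ℤ (H1 M)} (h : IsDualTo η Γ) (i j : Fin b) :
    (η i).potential.period (Γ j) = if i = j then 1 else 0 := by
  have hj : ∃ l : (a : M) × Path a a, IsSmoothPath n l.2 ∧
      loopClass (l.2 : C(I, M)) (by simp) = Γ j := by
    -- Without a smooth loop in the class `Γ j` the period would be the default value `0`, against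
    -- the diagonal value `1`.
    by_contra hne
    have := h j j
    rw [ClosedOneForm.period, dif_neg hne] at this
    simp at this
  rw [← h i j, ClosedOneForm.period, dif_pos hj, ClosedOneForm.pathIntegral_eq _ hj.choose_spec.1,
    ← LocalPotential.period_loopClass _ _ (by simp), hj.choose_spec.2]

theorem IsDualTo.period_potential_sum {b : ℕ} {η : Fin b → ClosedOneForm n M}
    {Γ : Module.Basis (Fin b) ℤ (H1 M)} (h : IsDualTo η Γ) (i : Fin b) (v : Fin b → ℤ) :
    (η i).potential.period (∑ j, v j • Γ j) = v i := by
  simp [h.period_potential]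

end Forms

/-! ### Smooth paths in a covering of a manifold -/

section SmoothPaths

variable {n : ℕ} {M : Type u} [TopologicalSpace M] [ChartedSpace (EuclideanSpace ℝ (Fin n)) M]
  {Mt : Type v} [TopologicalSpace Mt]

variable (n) in
/-- `x` and `y` are joined by a curve with smooth projection which is constant outside `[0,1]`. -/
def SmoothlyJoined (p : C(Mt, M)) (x y : Mt) : Prop :=
  ∃ g : ℝ → Mt, Continuous g ∧ ContMDiff 𝓘(ℝ, ℝ) (𝓡 n) ∞ (p ∘ g) ∧
    (∀ t ≤ 0, g t = x) ∧ ∀ t, 1 ≤ t → g t = y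

variable {p : C(Mt, M)} {x y z : Mt}

theorem SmoothlyJoined.symm (h : SmoothlyJoined n p x y) : SmoothlyJoined n p y x := by
  obtain ⟨g, hg, hs, h0, h1⟩ := h
  exact ⟨fun t => g (1 - t), by fun_prop,
    hs.comp (contMDiff_iff_contDiff.2 (contDiff_const.sub contDiff_id)),
    fun t ht => h1 _ (by linarith), fun t ht => h0 _ (by linarith)⟩

/-- Run the curves at triple speed: both are constantly `y` for times in `(1/3, 2/3)`, so the glued
curve agrees near every time with one of the two pieces and stays smooth. -/
theorem SmoothlyJoined.trans (h : SmoothlyJoined n p x y) (h' : SmoothlyJoined n p y z) :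
    SmoothlyJoined n p x z := by
  obtain ⟨g, hg, hs, h0, h1⟩ := h
  obtain ⟨g', hg', hs', h0', h1'⟩ := h'
  let k : ℝ → Mt := fun t => if t ≤ 1 / 2 then g (3 * t) else g' (3 * t - 2)
  have hl (t : ℝ) (ht : t < 2 / 3) : k t = g (3 * t) := by
    simp only [k]
    split_ifs with hif
    · rfl
    · rw [h0' _ (by linarith), h1 _ (by linarith)]
  have hr (t : ℝ) (ht : 1 / 3 < t) : k t = g' (3 * t - 2) := by
    simp only [k]
    split_ifs with hif
    · rw [h0' _ (by linarith), h1 _ (by linarith)]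
    · rfl
  have hsl : ContMDiff 𝓘(ℝ, ℝ) (𝓡 n) ∞ fun t => p (g (3 * t)) :=
    hs.comp (contMDiff_iff_contDiff.2 (contDiff_const.mul contDiff_id))
  have hsr : ContMDiff 𝓘(ℝ, ℝ) (𝓡 n) ∞ fun t => p (g' (3 * t - 2)) :=
    hs'.comp (contMDiff_iff_contDiff.2 ((contDiff_const.mul contDiff_id).sub contDiff_const))
  have hev (t : ℝ) : k =ᶠ[𝓝 t] (fun s => g (3 * s)) ∨ k =ᶠ[𝓝 t] fun s => g' (3 * s - 2) := by
    rcases lt_or_ge t (2 / 3) with ht | ht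
    · left
      filter_upwards [Iio_mem_nhds ht] with s hs
      exact hl s hs
    · right
      filter_upwards [Ioi_mem_nhds (show (1 : ℝ) / 3 < t by linarith)] with s hs
      exact hr s hs
  refine ⟨k, continuous_iff_continuousAt.2 fun t => ?_, fun t => ?_, fun t ht => ?_,
    fun t ht => ?_⟩
  · rcases hev t with h | h
    · exact (show Continuous fun s => g (3 * s) by fun_prop).continuousAt.congr h.symm
    · exact (show Continuous fun s => g' (3 * s - 2) by fun_prop).continuousAt.congr h.symm
  · rcases hev t with h | h
    · exact (hsl t).congr_of_eventuallyEq (h.fun_comp p)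
    · exact (hsr t).congr_of_eventuallyEq (h.fun_comp p)
  · rw [hl t (by linarith), h0 _ (by linarith)]
  · rw [hr t (by linarith), h1' _ (by linarith)]

/-- Take the straight segment in a chart, slowed down at its ends by `Real.smoothTransition`, and
lift it by a local inverse of `p`. -/
theorem eventually_smoothlyJoined [IsManifold (𝓡 n) ∞ M] (hp : IsLocalHomeomorph p) (x : Mt) :
    ∀ᶠ y in 𝓝 x, SmoothlyJoined n p x y := by
  obtain ⟨e, hx, he⟩ := hp x
  have hV : e.target ∈ 𝓝 (p x) := by
    rw [he]
    exact e.open_target.mem_nhds (e.map_source hx)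
  have hsymm : Tendsto (extChartAt (𝓡 n) (p x)).symm (𝓝 (extChartAt (𝓡 n) (p x) (p x)))
      (𝓝 (p x)) := by
    have : ContinuousAt (extChartAt (𝓡 n) (p x)).symm _ := continuousAt_extChartAt_symm (p x)
    rwa [ContinuousAt, extChartAt_to_inv] at this
  obtain ⟨r, hr, hB⟩ := Metric.eventually_nhds_iff_ball.1 ((hsymm.eventually hV).and
    (extChartAt_target_mem_nhds (p x)))
  filter_upwards [e.open_source.mem_nhds hx,
    p.continuous.continuousAt.eventually
      (extChartAt_source_mem_nhds (p x) : (extChartAt (𝓡 n) (p x)).source ∈ _),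
    p.continuous.continuousAt.eventually
      ((continuousAt_extChartAt (p x) : ContinuousAt (extChartAt (𝓡 n) (p x)) (p x)).eventually
        (Metric.ball_mem_nhds _ hr))] with y hy hyc hyB
  let l : ℝ → EuclideanSpace ℝ (Fin n) := fun t => AffineMap.lineMap
    (extChartAt (𝓡 n) (p x) (p x)) (extChartAt (𝓡 n) (p x) (p y)) (Real.smoothTransition t)
  have hl (t : ℝ) : l t ∈ Metric.ball (extChartAt (𝓡 n) (p x) (p x)) r :=
    (convex_ball _ r).lineMap_mem (Metric.mem_ball_self hr) hyB
      ⟨Real.smoothTransition.nonneg t, Real.smoothTransition.le_one t⟩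
  have hls : ContDiff ℝ ∞ l := by
    simp only [l, AffineMap.lineMap_apply, vsub_eq_sub, vadd_eq_add]
    exact (Real.smoothTransition.contDiff.smul contDiff_const).add contDiff_const
  have hs : ContMDiff 𝓘(ℝ, ℝ) (𝓡 n) ∞ fun t => (extChartAt (𝓡 n) (p x)).symm (l t) := by
    have h1 := (contMDiffOn_extChartAt_symm (n := ∞) (p x) :
      ContMDiffOn 𝓘(ℝ, EuclideanSpace ℝ (Fin n)) (𝓡 n) ∞ (extChartAt (𝓡 n) (p x)).symm _)
    rw [← contMDiffOn_univ]
    exact h1.comp hls.contMDiff.contMDiffOn fun t _ => (hB _ (hl t)).2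
  have hpe : p ∘ (fun t => e.symm ((extChartAt (𝓡 n) (p x)).symm (l t))) =
      fun t => (extChartAt (𝓡 n) (p x)).symm (l t) := by
    funext t
    exact (congrFun he _).trans (e.right_inv (hB _ (hl t)).1)
  refine ⟨fun t => e.symm ((extChartAt (𝓡 n) (p x)).symm (l t)),
    continuous_iff_continuousAt.2 fun t => (e.continuousAt_symm (hB _ (hl t)).1).comp
      (f := fun t => (extChartAt (𝓡 n) (p x)).symm (l t)) hs.continuous.continuousAt, ?_,
    fun t ht => ?_, fun t ht => ?_⟩
  · rw [hpe]
    exact hs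
  · simp only [l, Real.smoothTransition.zero_of_nonpos ht, AffineMap.lineMap_apply_zero,
      extChartAt_to_inv]
    rw [he, e.left_inv hx]
  · simp only [l, Real.smoothTransition.one_of_one_le ht, AffineMap.lineMap_apply_one]
    rw [(extChartAt (𝓡 n) (p x)).left_inv hyc, he, e.left_inv hy]

/-- The points smoothly joined to `x` form a nonempty clopen set. Hence the default value in
`abelJacobi` is never taken. -/
theorem exists_isSmoothPath [IsManifold (𝓡 n) ∞ M] [ConnectedSpace Mt] (hp : IsLocalHomeomorph p)
    (x y : Mt) : ∃ γ : Path x y, IsSmoothPath n (γ.map p.continuous) := by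
  have hclopen : IsClopen {z | SmoothlyJoined n p x z} := by
    refine ⟨⟨isOpen_iff_mem_nhds.2 fun z hz => ?_⟩, isOpen_iff_mem_nhds.2 fun z hz => ?_⟩
    · filter_upwards [eventually_smoothlyJoined (n := n) hp z] with w hw h
      exact hz (SmoothlyJoined.trans h hw.symm)
    · filter_upwards [eventually_smoothlyJoined (n := n) hp z] with w hw
      exact SmoothlyJoined.trans hz hw
  have huniv := hclopen.eq_univ ⟨x, fun _ => x, continuous_const, contMDiff_const,
    fun _ _ => rfl, fun _ _ => rfl⟩
  obtain ⟨g, hg, hs, h0, h1⟩ : SmoothlyJoined n p x y := huniv.symm.subset (mem_univ y)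
  refine ⟨⟨⟨fun t => g t, by fun_prop⟩, h0 _ le_rfl, h1 _ le_rfl⟩, ?_⟩
  refine hs.contMDiffOn.congr fun t ht => ?_
  rw [Path.extend_apply _ ht]
  rfl

end SmoothPaths

/-! ### The Abel–Jacobi map -/

namespace LocalPotential

variable {X Y : Type*} [TopologicalSpace X] [TopologicalSpace Y] (P : LocalPotential X)

theorem integral_eq_of_forall_mem {γ : C(I, X)} {i : X} (h : ∀ t, γ t ∈ P.U i) :
    P.integral γ = P.h i (γ 1) - P.h i (γ 0) :=
  IsPrimitive.integral_eq (F := P.h i ∘ γ) (.of_exists γ.continuous fun t =>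
    ⟨i, h t, Eventually.of_forall fun _ => rfl⟩)

/-- A point `y` near `x` is reached by lifting a short path that stays in `P.U (p x)`, so near `x`
the function `F` is a constant plus the potential composed with `p`. -/
theorem continuous_of_sub_eq_integral [LocallyPathConnectedSpace X] {p : C(Y, X)}
    (hp : IsLocalHomeomorph p) (hh : ∀ i, ContinuousOn (P.h i) (P.U i)) {F : Y → ℝ}
    (hF : ∀ (x y : Y) (γ : Path x y), F y - F x = P.integral (γ.map p.continuous)) :
    Continuous F := by
  refine continuous_iff_continuousAt.2 fun x => ?_
  obtain ⟨e, hx, he⟩ := hp x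
  have hV : P.U (p x) ∩ e.target ∈ 𝓝 (p x) := by
    refine inter_mem ((P.isOpen _).mem_nhds (P.mem _)) ?_
    rw [he]
    exact e.open_target.mem_nhds (e.map_source hx)
  obtain ⟨W, ⟨hW, hWc⟩, hWV⟩ := (LocallyPathConnectedSpace.path_connected_basis (p x)).mem_iff.1 hV
  have hcont : ContinuousAt (fun y => F x + (P.h (p x) (p y) - P.h (p x) (p x))) x :=
    continuousAt_const.add ((((hh (p x)).continuousAt ((P.isOpen _).mem_nhds (P.mem _))).comp
      p.continuous.continuousAt).sub continuousAt_const)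
  refine hcont.congr ?_
  filter_upwards [e.open_source.mem_nhds hx, p.continuous.continuousAt hW] with y hy hyW
  obtain ⟨γ, hγ⟩ := hWc.joinedIn (p x) (mem_of_mem_nhds hW) (p y) hyW
  let Γ : Path x y :=
    { toFun := fun t => e.symm (γ t)
      continuous_toFun := e.continuousOn_symm.comp_continuous γ.continuous
        fun t => (hWV (hγ t)).2
      source' := by rw [γ.source, he, e.left_inv hx]
      target' := by rw [γ.target, he, e.left_inv hy] }
  have hΓ (t : I) : (Γ.map p.continuous : Path (p x) (p y)) t = γ t :=
    (congrFun he _).trans (e.right_inv (hWV (hγ t)).2)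
  have h1 := P.integral_eq_of_forall_mem (γ := Γ.map p.continuous) (i := p x) fun t => by
    change (Γ.map p.continuous : Path (p x) (p y)) t ∈ _
    rw [hΓ]
    exact (hWV (hγ t)).1
  have h2 := hF x y Γ
  rw [h1] at h2
  simp only [ContinuousMap.coe_coe, Path.source, Path.target] at h2
  linarith

end LocalPotential

section AbelJacobi

variable {n b : ℕ} {M : Type u} [TopologicalSpace M] [ChartedSpace (EuclideanSpace ℝ (Fin n)) M]
  [IsManifold (𝓡 n) ∞ M] {Mt : Type v} [TopologicalSpace Mt] {p : C(Mt, M)}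

/-- The smooth path chosen in the definition may be replaced by any continuous one, since the
projected fundamental group consists of commutators. -/
theorem abelJacobi_eq (hp : IsUniversalAbelianCover p) (η : Fin b → ClosedOneForm n M)
    (x₀ : Mt) {x : Mt} (γ : Path x₀ x) (i : Fin b) :
    abelJacobi p η x₀ x i = (η i).potential.integral (γ.map p.continuous) := by
  have := hp.pathConnected
  have h := exists_isSmoothPath (n := n) hp.isCoveringMap.isLocalHomeomorph x₀ x
  rw [abelJacobi, dif_pos h, (η i).pathIntegral_eq h.choose_spec]
  exact (η i).potential.integral_eq_of_range_le _ _ (hp.range_eq x₀).le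

theorem abelJacobi_sub (hp : IsUniversalAbelianCover p) (η : Fin b → ClosedOneForm n M)
    (x₀ : Mt) {x y : Mt} (γ : Path x y) (i : Fin b) :
    abelJacobi p η x₀ y i - abelJacobi p η x₀ x i =
      (η i).potential.integral (γ.map p.continuous) := by
  have := hp.pathConnected
  let γ₀ := PathConnectedSpace.somePath x₀ x
  rw [abelJacobi_eq hp η x₀ γ₀, abelJacobi_eq hp η x₀ (γ₀.trans γ), Path.map_trans,
    LocalPotential.integral_trans]
  ring

theorem continuous_abelJacobi (hp : IsUniversalAbelianCover p) (η : Fin b → ClosedOneForm n M)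
    (x₀ : Mt) : Continuous (abelJacobi p η x₀) := by
  have := ChartedSpace.locallyPathConnectedSpace (EuclideanSpace ℝ (Fin n)) M
  refine continuous_pi fun i => (η i).potential.continuous_of_sub_eq_integral
    hp.isCoveringMap.isLocalHomeomorph (fun j x hx => ?_) fun x y γ => abelJacobi_sub hp η x₀ γ i
  exact ((η i).contMDiffAt_potential hx).continuousAt.continuousWithinAt

end AbelJacobi

/-! ### Translates in the universal Abelian cover -/

section Translates

variable {b : ℕ} {M : Type u} [TopologicalSpace M] {Mt : Type v} [TopologicalSpace Mt]

/-- `y` is the end point of a path starting at `x` which projects to a loop of homology class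
`∑ v_j Γ_j`. -/
def IsTranslate (Γ : Module.Basis (Fin b) ℤ (H1 M)) (p : C(Mt, M)) (v : Fin b → ℤ) (x y : Mt) :
    Prop :=
  ∃ (γ : Path x y) (hy : p x = p y),
    loopClass ((γ.map p.continuous : Path (p x) (p y)) : C(I, M)) (by simp [hy]) = ∑ j, v j • Γ j

variable {Γ : Module.Basis (Fin b) ℤ (H1 M)} {p : C(Mt, M)} {v : Fin b → ℤ} {x y : Mt}

theorem sum_zsmul_basis (Γ : Module.Basis (Fin b) ℤ (H1 M)) (v : Fin b → ℤ) :
    ∑ j, v j • Γ j = Γ.equivFun.symm v := by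
  apply Γ.equivFun.injective
  funext i
  rw [LinearEquiv.apply_symm_apply, map_sum, Finset.sum_apply]
  simp only [map_zsmul, Pi.smul_apply, Module.Basis.equivFun_apply, Module.Basis.repr_self]
  simp [Finsupp.single_apply]

theorem exists_isTranslate [PathConnectedSpace Mt] (h : p x = p y) :
    ∃ v, IsTranslate Γ p v x y :=
  ⟨_, PathConnectedSpace.somePath x y, h,
    ((sum_zsmul_basis Γ _).trans (Γ.equivFun.symm_apply_apply _)).symm⟩

theorem isTranslate_zero (x : Mt) : IsTranslate Γ p 0 x x := by
  refine ⟨Path.refl x, rfl, ?_⟩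
  rw [sum_zsmul_basis, map_zero]
  exact loopClass_const (p x)

/-- The image path under `ft` projects to `f` applied to the original loop, whose class is given by
naturality. -/
theorem IsTranslate.map {f : C(M, M)} {ft : C(Mt, Mt)} (hft : ∀ x, p (ft x) = f (p x))
    (h : IsTranslate Γ p v x y) :
    IsTranslate Γ p ((homologyMatrix Γ f).mulVec v) (ft x) (ft y) := by
  obtain ⟨γ, hy, hc⟩ := h
  refine ⟨γ.map ft.continuous, by rw [hft, hft, hy], ?_⟩
  have e : (((γ.map ft.continuous).map p.continuous : Path (p (ft x)) (p (ft y))) : C(I, M)) =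
      f.comp (γ.map p.continuous : Path (p x) (p y)) := by
    ext t
    exact hft _
  simp only [e]
  rw [← H1map_loopClass _ _ (by simp [hy]), hc, sum_zsmul_basis, sum_zsmul_basis,
    LinearEquiv.eq_symm_apply, homologyMatrix]
  have := LinearMap.toMatrix_mulVec_repr Γ Γ (H1map f) (Γ.equivFun.symm v)
  rw [← Module.Basis.equivFun_apply, ← Module.Basis.equivFun_apply,
    LinearEquiv.apply_symm_apply] at this
  exact this.symm

theorem IsTranslate.iterate {f : C(M, M)} {ft : C(Mt, Mt)} (hft : ∀ x, p (ft x) = f (p x))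
    (h : IsTranslate Γ p v x y) (k : ℕ) :
    IsTranslate Γ p ((homologyMatrix Γ f ^ k).mulVec v) (ft^[k] x) (ft^[k] y) := by
  induction k with
  | zero => simpa using h
  | succ k ih =>
    rw [Function.iterate_succ_apply', Function.iterate_succ_apply', pow_succ',
      ← Matrix.mulVec_mulVec]
    exact ih.map hft

/-- Lift the reversed loop starting from `x`. -/
theorem IsTranslate.exists_neg (hp : IsCoveringMap p) (h : IsTranslate Γ p v x y) :
    ∃ z, IsTranslate Γ p (-v) x z := by
  obtain ⟨γ, hy, hc⟩ := h
  let δ : Path (p x) (p x) := (γ.map p.continuous).cast rfl hy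
  let L := hp.liftPath δ.symm x (by simp)
  have hL : p ∘ L = δ.symm := hp.liftPath_lifts _ _ _
  have h0 : L 0 = x := hp.liftPath_zero _ _ _
  have h1 : p (L 1) = p x := (congrFun hL 1).trans δ.symm.target
  refine ⟨L 1, ⟨L, h0, rfl⟩, h1.symm, ?_⟩
  have e : ((Path.map (⟨L, h0, rfl⟩ : Path x (L 1)) p.continuous : Path (p x) (p (L 1))) :
      C(I, M)) = δ.symm := by
    ext t
    exact congrFun hL t
  simp only [e]
  rw [loopClass_symm]
  rw [sum_zsmul_basis, map_neg, ← sum_zsmul_basis, ← hc]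
  rfl

theorem isTranslate_deck (h : ∃ y, IsTranslate Γ p v x y) : IsTranslate Γ p v x (deck Γ p v x) := by
  unfold deck
  exact (dif_pos h).symm ▸ h.choose_spec

theorem deck_eq_self (h : ¬ ∃ y, IsTranslate Γ p v x y) : deck Γ p v x = x := by
  exact dif_neg h

/-- The default value of `deck` is the point itself. If `x` had no `v`-translate it would have no
`-v`-translate either, and would lie in both tiles `δ_v M₀` and `δ_{-v} M₀`, which are disjoint for
`v ≠ 0`. So there is no need to know that every homology class is carried by a loop at `p x`. -/
theorem IsFundamentalDomain.isTranslate_deck {M₀ : Set Mt} (hM : IsFundamentalDomain Γ p M₀)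
    (hp : IsCoveringMap p) (hx : x ∈ M₀) : IsTranslate Γ p v x (deck Γ p v x) := by
  refine AbelianCover.isTranslate_deck ?_
  by_contra hne
  have hne' : ¬ ∃ y, IsTranslate Γ p (-v) x y := by
    rintro ⟨y, hy⟩
    have := hy.exists_neg hp
    rw [neg_neg] at this
    exact hne this
  have hv : v ≠ -v := by
    intro h
    have : v = 0 := self_eq_neg.1 h
    exact hne ⟨x, this ▸ isTranslate_zero x⟩
  exact disjoint_left.1 (hM.pairwise_disjoint hv) ⟨x, hx, deck_eq_self hne⟩
    ⟨x, hx, deck_eq_self hne'⟩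

theorem IsFundamentalDomain.mem_tileIndex {M₀ : Set Mt} (hM : IsFundamentalDomain Γ p M₀)
    (x : Mt) : x ∈ deck Γ p (tileIndex Γ p M₀ x) '' M₀ := by
  have h : ∃ v : Fin b → ℤ, x ∈ deck Γ p v '' M₀ := mem_iUnion.1 (hM.iUnion_eq.symm ▸ mem_univ x)
  rw [tileIndex, dif_pos h]
  exact h.choose_spec

variable (Γ p) in
/-- A continuous map to `ℝ^b` which intertwines deck transformations and integer translations. -/
structure IsEquivariant (J : Mt → Fin b → ℝ) : Prop where
  continuous : Continuous J
  map_translate : ∀ {v : Fin b → ℤ} {x y : Mt}, IsTranslate Γ p v x y →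
    J y = J x + fun i => (v i : ℝ)

/-- Subtracting the tile index from `J x` gives the value of `J` at a point of `M₀`, whose closure
is compact. -/
theorem IsEquivariant.exists_norm_sub_tileIndex_le {J : Mt → Fin b → ℝ}
    (hJ : IsEquivariant Γ p J) (hp : IsCoveringMap p) {M₀ : Set Mt}
    (hM : IsFundamentalDomain Γ p M₀) :
    ∃ C, ∀ x, ‖J x - fun i => (tileIndex Γ p M₀ x i : ℝ)‖ ≤ C := by
  obtain ⟨C, hC⟩ := hM.isCompact_closure.exists_bound_of_continuousOn hJ.continuous.continuousOn
  refine ⟨C, fun x => ?_⟩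
  obtain ⟨y, hy, hyx⟩ := hM.mem_tileIndex x
  have h := hJ.map_translate (hM.isTranslate_deck (v := tileIndex Γ p M₀ x) hp hy)
  rw [hyx] at h
  rw [h, add_sub_cancel_right]
  exact hC y (subset_closure hy)

/-- A continuous function on the cover which is constant on the fibres is bounded. -/
theorem exists_norm_le_of_factorsThrough [CompactSpace M] (hp : IsQuotientMap p)
    {g : Mt → Fin b → ℝ} (hg : Continuous g) (h : Function.FactorsThrough g p) :
    ∃ C, ∀ x, ‖g x‖ ≤ C := by
  let G := hp.lift ⟨g, hg⟩ h
  obtain ⟨C, hC⟩ := isCompact_univ.exists_bound_of_continuousOn G.continuous.continuousOn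
  refine ⟨C, fun x => ?_⟩
  have := hC (p x) (mem_univ _)
  have e : G (p x) = g x := congrFun (congrArg DFunLike.coe (hp.lift_comp ⟨g, hg⟩ h)) x
  rwa [e] at this

theorem IsUniversalAbelianCover.isQuotientMap [ConnectedSpace M]
    (hp : IsUniversalAbelianCover p) [LocallyPathConnectedSpace M] : IsQuotientMap p := by
  have := hp.pathConnected
  refine hp.isCoveringMap.isQuotientMap fun y => ?_
  have : PathConnectedSpace M := pathConnectedSpace_iff_connectedSpace.2 inferInstance
  obtain ⟨x⟩ : Nonempty Mt := inferInstance
  let γ := PathConnectedSpace.somePath (p x) y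
  refine ⟨hp.isCoveringMap.liftPath γ x (by simp) 1, ?_⟩
  exact (congrFun (hp.isCoveringMap.liftPath_lifts γ x (by simp)) 1).trans γ.target

end Translates

theorem isEquivariant_abelJacobi {n b : ℕ} {M : Type u} [TopologicalSpace M]
    [ChartedSpace (EuclideanSpace ℝ (Fin n)) M] [IsManifold (𝓡 n) ∞ M] {Mt : Type v}
    [TopologicalSpace Mt] {p : C(Mt, M)} (hp : IsUniversalAbelianCover p)
    {Γ : Module.Basis (Fin b) ℤ (H1 M)} {η : Fin b → ClosedOneForm n M} (hη : IsDualTo η Γ)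
    (x₀ : Mt) : IsEquivariant Γ p (abelJacobi p η x₀) where
  continuous := continuous_abelJacobi hp η x₀
  map_translate := by
    rintro v x y ⟨γ, hy, hc⟩
    funext i
    have h1 := abelJacobi_sub hp η x₀ γ i
    rw [← LocalPotential.period_loopClass _ _ (by simp [hy]), hc, hη.period_potential_sum] at h1
    rw [Pi.add_apply, ← h1]
    ring

/-! ### Expanding integer matrices -/

section Expanding

variable {b : ℕ} {A : Matrix (Fin b) (Fin b) ℤ}

/-- Zero is not an eigenvalue over `ℂ`; the integer determinant carries this over to `ℝ`. -/
theorem IsExpanding.isUnit_realMatrix (hA : IsExpanding A) : IsUnit (realMatrix A) := by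
  have h0 : (0 : ℂ) ∉ spectrum ℂ (A.map (Int.cast : ℤ → ℂ)) := by
    rw [← Matrix.spectrum_toLin', ← Module.End.hasEigenvalue_iff_mem_spectrum]
    intro h
    have := hA 0 h
    simp at this
    linarith
  rw [spectrum.zero_notMem_iff, Matrix.isUnit_iff_isUnit_det, isUnit_iff_ne_zero] at h0
  rw [Matrix.isUnit_iff_isUnit_det, isUnit_iff_ne_zero]
  have h1 : (A.map (Int.cast : ℤ → ℂ)).det = (A.det : ℂ) :=
    ((Int.castRingHom ℂ).map_det A).symm
  have h2 : (realMatrix A).det = (A.det : ℝ) := ((Int.castRingHom ℝ).map_det A).symm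
  rw [h1, Int.cast_ne_zero] at h0
  rwa [h2, Int.cast_ne_zero]

section Norm

attribute [local instance] Matrix.linftyOpNormedRing Matrix.linftyOpNormedAlgebra

theorem linfty_opNorm_map_ofReal (B : Matrix (Fin b) (Fin b) ℝ) :
    ‖B.map (Complex.ofReal : ℝ → ℂ)‖ = ‖B‖ := by
  have : ‖B.map (Complex.ofReal : ℝ → ℂ)‖₊ = ‖B‖₊ := by
    simp [Matrix.linfty_opNNNorm_def]
  exact congrArg NNReal.toReal this

/-- The eigenvalues of the inverse lie in the open unit disc, so Gelfand's formula bounds the norms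
of its powers by `r ^ k` for large `k`, with some `r < 1`. Complexification preserves the norm. -/
theorem IsExpanding.summable_norm_inv_pow (hA : IsExpanding A) :
    Summable fun k : ℕ => ‖(realMatrix A)⁻¹ ^ k‖ := by
  -- For `b = 0` the spectrum is empty and the argument below does not apply.
  rcases Nat.eq_zero_or_pos b with rfl | hb
  · refine summable_zero.congr fun k => ?_
    rw [Subsingleton.elim ((realMatrix A)⁻¹ ^ k) 0, norm_zero]
  have : Nonempty (Fin b) := ⟨⟨0, hb⟩⟩
  let φ : Matrix (Fin b) (Fin b) ℝ →+* Matrix (Fin b) (Fin b) ℂ := Complex.ofRealHom.mapMatrix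
  have hdet := (Matrix.isUnit_iff_isUnit_det _).1 hA.isUnit_realMatrix
  have hφA : φ (realMatrix A) = A.map (Int.cast : ℤ → ℂ) := by
    ext i j
    simp [φ]
  let a : (Matrix (Fin b) (Fin b) ℂ)ˣ :=
    ⟨φ (realMatrix A), φ (realMatrix A)⁻¹, by rw [← map_mul, Matrix.mul_nonsing_inv _ hdet, map_one],
      by rw [← map_mul, Matrix.nonsing_inv_mul _ hdet, map_one]⟩
  have hspec : ∀ μ ∈ spectrum ℂ (φ (realMatrix A)⁻¹), ‖μ‖₊ < 1 := by
    intro μ hμ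
    have h1 : μ⁻¹ ∈ spectrum ℂ (a : Matrix (Fin b) (Fin b) ℂ) := spectrum.inv₀_mem_iff.2 hμ
    change μ⁻¹ ∈ spectrum ℂ (φ (realMatrix A)) at h1
    rw [hφA, ← Matrix.spectrum_toLin', ← Module.End.hasEigenvalue_iff_mem_spectrum] at h1
    have h2 := hA _ h1
    rw [norm_inv] at h2
    have h3 : 0 < ‖μ‖ := inv_pos.1 (zero_lt_one.trans h2)
    exact (one_lt_inv₀ h3).1 h2
  have hr := spectrum.spectralRadius_lt_of_forall_lt_of_nonempty
    (spectrum.nonempty (φ (realMatrix A)⁻¹)) hspec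
  obtain ⟨r, hr1, hr2⟩ := ENNReal.lt_iff_exists_nnreal_btwn.1 hr
  have hr2' : r < 1 := by exact_mod_cast hr2
  have hev := (spectrum.pow_nnnorm_pow_one_div_tendsto_nhds_spectralRadius
    (φ (realMatrix A)⁻¹)).eventually_lt_const hr1
  refine Summable.of_norm_bounded_eventually_nat (g := fun k => (r : ℝ) ^ k)
    (summable_geometric_of_lt_one r.2 hr2') ?_
  filter_upwards [hev, eventually_gt_atTop 0] with k hk hk0
  rw [norm_norm, ← linfty_opNorm_map_ofReal]
  have e : ((realMatrix A)⁻¹ ^ k).map (Complex.ofReal : ℝ → ℂ) = φ (realMatrix A)⁻¹ ^ k :=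
    map_pow φ _ k
  rw [e]
  have h1 : (‖φ (realMatrix A)⁻¹ ^ k‖₊ : ENNReal) ≤ (r : ENNReal) ^ k := by
    have hk' : (0 : ℝ) < k := by exact_mod_cast hk0
    have := ENNReal.rpow_le_rpow hk.le hk'.le
    rwa [← ENNReal.rpow_mul, one_div_mul_cancel hk'.ne', ENNReal.rpow_one,
      ENNReal.rpow_natCast] at this
  exact_mod_cast h1

/-- Stated with vector norms only, so that the matrix norm stays local. -/
theorem IsExpanding.exists_summable_bound (hA : IsExpanding A) : ∃ w : ℕ → ℝ, Summable w ∧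
    (∀ k, 0 ≤ w k) ∧ ∀ k v, ‖((realMatrix A)⁻¹ ^ k).mulVec v‖ ≤ w k * ‖v‖ :=
  ⟨_, hA.summable_norm_inv_pow, fun _ => norm_nonneg _, fun _ _ => Matrix.linfty_opNorm_mulVec _ _⟩

end Norm

theorem IsExpanding.inv_pow_mulVec_pow_mulVec (hA : IsExpanding A) (k : ℕ) (v : Fin b → ℝ) :
    ((realMatrix A)⁻¹ ^ k).mulVec ((realMatrix A ^ k).mulVec v) = v := by
  rw [Matrix.mulVec_mulVec, Matrix.inv_pow', Matrix.nonsing_inv_mul _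
    ((Matrix.isUnit_iff_isUnit_det _).1 (hA.isUnit_realMatrix.pow k)), Matrix.one_mulVec]

theorem IsExpanding.tendsto_inv_pow_mulVec (hA : IsExpanding A) {c : ℕ → Fin b → ℝ} {C : ℝ}
    (hc : ∀ k, ‖c k‖ ≤ C) :
    Tendsto (fun k => ((realMatrix A)⁻¹ ^ k).mulVec (c k)) atTop (𝓝 0) := by
  obtain ⟨w, hw, hw0, hwb⟩ := hA.exists_summable_bound
  refine squeeze_zero_norm (a := fun k => w k * C)
    (fun k => (hwb k _).trans (mul_le_mul_of_nonneg_left (hc k) (hw0 k))) ?_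
  simpa using hw.tendsto_atTop_zero.mul_const C

/-- A vector fixed by `Aᵏ` is fixed by every `A⁻ᵏᵐ`, yet these images tend to zero. -/
theorem IsExpanding.isUnit_pow_sub_one (hA : IsExpanding A) {k : ℕ} (hk : 1 ≤ k) :
    IsUnit (realMatrix A ^ k - 1) := by
  rw [Matrix.isUnit_iff_isUnit_det, isUnit_iff_ne_zero]
  intro hdet
  obtain ⟨v, hv, h⟩ := Matrix.exists_mulVec_eq_zero_iff.2 hdet
  rw [Matrix.sub_mulVec, Matrix.one_mulVec, sub_eq_zero] at h
  have hfix (m : ℕ) : (realMatrix A ^ (k * m)).mulVec v = v := by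
    induction m with
    | zero => simp
    | succ m ih => rw [Nat.mul_succ, pow_add, ← Matrix.mulVec_mulVec, h, ih]
  have h1 := (hA.tendsto_inv_pow_mulVec (c := fun _ => v) (fun _ => le_rfl)).comp
    (tendsto_id.const_mul_atTop' (Nat.pos_of_ne_zero (by omega) : 0 < k))
  have h2 (m : ℕ) : ((realMatrix A)⁻¹ ^ (k * m)).mulVec v = v := by
    conv_lhs => rw [← hfix m]
    exact hA.inv_pow_mulVec_pow_mulVec _ _
  refine hv (tendsto_nhds_unique (f := fun _ : ℕ => v) (l := atTop) tendsto_const_nhds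
    (h1.congr fun m => ?_))
  exact h2 m

/-- If `A^{-k} d_k` converges, then `(A^k - 1)^{-1} d_k` converges to the same limit. -/
theorem IsExpanding.tendsto_inv_pow_sub_one_mulVec (hA : IsExpanding A) {d : ℕ → Fin b → ℝ}
    {L : Fin b → ℝ} (h : Tendsto (fun k => ((realMatrix A)⁻¹ ^ k).mulVec (d k)) atTop (𝓝 L)) :
    Tendsto (fun k => ((realMatrix A) ^ k - 1)⁻¹.mulVec (d k)) atTop (𝓝 L) := by
  obtain ⟨w, hw, hw0, hwb⟩ := hA.exists_summable_bound
  set q : ℕ → Fin b → ℝ := fun k => ((realMatrix A) ^ k - 1)⁻¹.mulVec (d k) with hq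
  have hrel (k : ℕ) (hk : 1 ≤ k) : q k =
      ((realMatrix A)⁻¹ ^ k).mulVec (d k) + ((realMatrix A)⁻¹ ^ k).mulVec (q k) := by
    have h1 : (realMatrix A ^ k - 1).mulVec (q k) = d k := by
      rw [hq, Matrix.mulVec_mulVec, Matrix.mul_nonsing_inv _
        ((Matrix.isUnit_iff_isUnit_det _).1 (hA.isUnit_pow_sub_one hk)), Matrix.one_mulVec]
    rw [← h1, Matrix.sub_mulVec, Matrix.one_mulVec, Matrix.mulVec_sub,
      hA.inv_pow_mulVec_pow_mulVec]
    simp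
  -- Once the contraction factor is below `1/2`, `hrel` gives `‖q k‖ ≤ 2 (‖L‖ + 1)`, so its last
  -- term tends to zero.
  have hsmall : ∀ᶠ k in atTop, w k < 1 / 2 :=
    hw.tendsto_atTop_zero.eventually_lt_const (by norm_num)
  have hbd : ∀ᶠ k in atTop, ‖((realMatrix A)⁻¹ ^ k).mulVec (d k)‖ < ‖L‖ + 1 :=
    h.norm.eventually_lt_const (by linarith)
  have hzero : Tendsto (fun k => ((realMatrix A)⁻¹ ^ k).mulVec (q k)) atTop (𝓝 0) := by
    refine squeeze_zero_norm' (a := fun k => w k * (2 * (‖L‖ + 1))) ?_ ?_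
    · filter_upwards [hsmall, hbd, eventually_ge_atTop 1] with k h1 h2 h3
      have h4 := hwb k (q k)
      have h5 : ‖q k‖ ≤ ‖((realMatrix A)⁻¹ ^ k).mulVec (d k)‖ +
          ‖((realMatrix A)⁻¹ ^ k).mulVec (q k)‖ := by
        conv_lhs => rw [hrel k h3]
        exact norm_add_le _ _
      have h6 : w k * ‖q k‖ ≤ 1 / 2 * ‖q k‖ := mul_le_mul_of_nonneg_right h1.le (norm_nonneg _)
      exact h4.trans (mul_le_mul_of_nonneg_left (by linarith) (hw0 k))
    · simpa using hw.tendsto_atTop_zero.mul_const (2 * (‖L‖ + 1))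
  have := h.add hzero
  rw [add_zero] at this
  refine this.congr' ?_
  filter_upwards [eventually_ge_atTop 1] with k hk
  exact (hrel k hk).symm

end Expanding

/-! ### The limit map -/

section Limit

variable {b : ℕ} {M : Type u} [TopologicalSpace M] {Mt : Type v} [TopologicalSpace Mt]
  {Γ : Module.Basis (Fin b) ℤ (H1 M)} {p : C(Mt, M)} {f : C(M, M)} {ft : C(Mt, Mt)}
  {J J' : Mt → Fin b → ℝ}

theorem realMatrix_mulVec_intCast (B : Matrix (Fin b) (Fin b) ℤ) (v : Fin b → ℤ) :
    (realMatrix B).mulVec (fun i => (v i : ℝ)) = fun i => ((B.mulVec v) i : ℝ) := by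
  funext i
  simp [Matrix.mulVec, dotProduct]

theorem realMatrix_pow (B : Matrix (Fin b) (Fin b) ℤ) (k : ℕ) :
    realMatrix (B ^ k) = realMatrix B ^ k :=
  map_pow (Int.castRingHom ℝ).mapMatrix B k

theorem IsEquivariant.iterate_apply (hJ : IsEquivariant Γ p J) (hft : ∀ x, p (ft x) = f (p x))
    {v : Fin b → ℤ} {x y : Mt} (h : IsTranslate Γ p v x y) (k : ℕ) :
    J (ft^[k] y) = J (ft^[k] x) +
      (realMatrix (homologyMatrix Γ f) ^ k).mulVec fun i => (v i : ℝ) := by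
  rw [hJ.map_translate (h.iterate hft k), ← realMatrix_pow, realMatrix_mulVec_intCast]

variable [CompactSpace M] [PathConnectedSpace Mt]

/-- Both maps move by the same integer vector along a fibre, so their difference descends to the
compact `M`. This yields independence of the forms and the base point. -/
theorem IsEquivariant.exists_norm_sub_le (hp : IsQuotientMap p) (hJ : IsEquivariant Γ p J)
    (hJ' : IsEquivariant Γ p J') : ∃ C, ∀ x, ‖J x - J' x‖ ≤ C := by
  refine exists_norm_le_of_factorsThrough hp (hJ.continuous.sub hJ'.continuous) fun x y hxy => ?_
  obtain ⟨v, hv⟩ := exists_isTranslate (Γ := Γ) hxy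
  simp [hJ.map_translate hv, hJ'.map_translate hv]

theorem IsEquivariant.exists_tendsto (hp : IsQuotientMap p) (hJ : IsEquivariant Γ p J)
    (hft : ∀ x, p (ft x) = f (p x)) (hA : IsExpanding (homologyMatrix Γ f)) :
    ∃ β : Mt → Fin b → ℝ, IsEquivariant Γ p β ∧
      (∀ x, β (ft x) = (realMatrix (homologyMatrix Γ f)).mulVec (β x)) ∧
      ∀ x, Tendsto (fun k => ((realMatrix (homologyMatrix Γ f))⁻¹ ^ k).mulVec (J (ft^[k] x)))
        atTop (𝓝 (β x)) := by
  set B := realMatrix (homologyMatrix Γ f) with hB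
  have hBdet := (Matrix.isUnit_iff_isUnit_det _).1 hA.isUnit_realMatrix
  have hmul (L : Matrix (Fin b) (Fin b) ℝ) : Continuous fun v => L.mulVec v :=
    continuous_const.matrix_mulVec continuous_id
  obtain ⟨w, hw, hw0, hwb⟩ := hA.exists_summable_bound
  let g : Mt → Fin b → ℝ := fun x => B⁻¹.mulVec (J (ft x)) - J x
  have hgc : Continuous g :=
    ((hmul _).comp (hJ.continuous.comp ft.continuous)).sub hJ.continuous
  -- Translation by `v` changes `g` by `A⁻¹ A v - v = 0`.
  obtain ⟨C, hC⟩ := exists_norm_le_of_factorsThrough hp hgc fun x y hxy => by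
    obtain ⟨v, hv⟩ := exists_isTranslate (Γ := Γ) hxy
    have h1 := hJ.iterate_apply hft hv 1
    have h2 := hA.inv_pow_mulVec_pow_mulVec 1 fun i => (v i : ℝ)
    simp only [Function.iterate_one, pow_one] at h1 h2
    simp only [g, h1, hJ.map_translate hv, Matrix.mulVec_add, hB, h2]
    abel
  have hterm (j : ℕ) (x : Mt) : ‖(B⁻¹ ^ j).mulVec (g (ft^[j] x))‖ ≤ w j * C :=
    (hwb j _).trans (mul_le_mul_of_nonneg_left (hC _) (hw0 j))
  have hsum : Summable fun j => w j * C := hw.mul_right C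
  have hpart (x : Mt) (k : ℕ) : (B⁻¹ ^ k).mulVec (J (ft^[k] x)) =
      J x + ∑ j ∈ Finset.range k, (B⁻¹ ^ j).mulVec (g (ft^[j] x)) := by
    induction k with
    | zero => simp
    | succ k ih =>
      rw [Finset.sum_range_succ, ← add_assoc, ← ih]
      simp only [g, Matrix.mulVec_sub, Matrix.mulVec_mulVec, ← pow_succ,
        ← Function.iterate_succ_apply']
      abel
  let β : Mt → Fin b → ℝ := fun x => J x + ∑' j, (B⁻¹ ^ j).mulVec (g (ft^[j] x))
  have hlim (x : Mt) : Tendsto (fun k => (B⁻¹ ^ k).mulVec (J (ft^[k] x))) atTop (𝓝 (β x)) := by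
    simp only [hpart]
    exact tendsto_const_nhds.add
      (Summable.of_norm_bounded hsum fun j => hterm j x).hasSum.tendsto_sum_nat
  refine ⟨β, ⟨?_, ?_⟩, fun x => ?_, hlim⟩
  · exact hJ.continuous.add (continuous_tsum
      (fun j => (hmul _).comp (hgc.comp (ft.continuous.iterate j))) hsum hterm)
  · intro v x y hxy
    refine tendsto_nhds_unique (hlim y) (((hlim x).add_const _).congr fun k => ?_)
    rw [hJ.iterate_apply hft hxy, Matrix.mulVec_add, hA.inv_pow_mulVec_pow_mulVec]
  -- Shift the index: `A` times the term of index `k + 1` at `x` is the term of index `k` at `ft x`.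
  · refine tendsto_nhds_unique (hlim (ft x)) ((((hmul B).tendsto _).comp
      ((hlim x).comp (tendsto_add_atTop_nat 1))).congr fun k => ?_)
    simp only [Function.comp_apply]
    rw [Matrix.mulVec_mulVec, pow_succ', ← mul_assoc, Matrix.mul_nonsing_inv _ hBdet, one_mul,
      Function.iterate_succ_apply]

end Limit

theorem toTorus_add_intCast {b : ℕ} (w : Fin b → ℝ) (v : Fin b → ℤ) :
    toTorus (w + fun i => (v i : ℝ)) = toTorus w := by
  funext i
  simp [toTorus]

theorem continuous_toTorus {b : ℕ} : Continuous (toTorus (b := b)) :=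
  continuous_pi fun i => (AddCircle.continuous_mk' 1).comp (continuous_apply i)

theorem toTorus_mulVec {b : ℕ} (A : Matrix (Fin b) (Fin b) ℤ) (w : Fin b → ℝ) :
    toTorus ((realMatrix A).mulVec w) = toralEndo A (toTorus w) := by
  funext i
  simp only [toTorus, toralEndo, Matrix.mulVec, dotProduct, Matrix.map_apply]
  rw [← QuotientAddGroup.mk'_apply, map_sum]
  refine Finset.sum_congr rfl fun j _ => ?_
  rw [← zsmul_eq_mul, map_zsmul]
  rfl

/-! ### The semiconjugacy -/

section Beta

variable {n b : ℕ} {M : Type u} [TopologicalSpace M] [ChartedSpace (EuclideanSpace ℝ (Fin n)) M]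
  {Mt : Type v} [TopologicalSpace Mt] {Γ : Module.Basis (Fin b) ℤ (H1 M)} {p : C(Mt, M)}
  {f : C(M, M)} {ft : C(Mt, Mt)} {A : Matrix (Fin b) (Fin b) ℤ} {η : Fin b → ClosedOneForm n M}
  {x₀ : Mt}

/-- The lift chosen in `beta` differs from `x` by a translation, which changes `β̃` by an integer
vector. -/
theorem beta_apply [PathConnectedSpace Mt] (h : IsEquivariant Γ p (betaLift A p η x₀ ft))
    (x : Mt) : beta A p η x₀ ft (p x) = toTorus (betaLift A p η x₀ ft x) := by
  have hx : ∃ y, p y = p x := ⟨x, rfl⟩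
  obtain ⟨v, hv⟩ := exists_isTranslate (Γ := Γ) hx.choose_spec
  rw [beta, dif_pos hx, h.map_translate hv, toTorus_add_intCast]

/-- The displacement differs from `J (ft^[k] x)` by a vector bounded uniformly in `k`, which the
contraction kills. -/
theorem IsEquivariant.tendsto_inv_pow_displacement {J β : Mt → Fin b → ℝ}
    (hJ : IsEquivariant Γ p J) (hp : IsCoveringMap p) (hA : IsExpanding A) {x : Mt}
    (hlim : Tendsto (fun k => ((realMatrix A)⁻¹ ^ k).mulVec (J (ft^[k] x))) atTop (𝓝 (β x)))
    {M₀ : Set Mt} (hM : IsFundamentalDomain Γ p M₀) :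
    Tendsto (fun k => ((realMatrix A)⁻¹ ^ k).mulVec
      fun i => (displacement Γ p M₀ ft k x i : ℝ)) atTop (𝓝 (β x)) := by
  obtain ⟨C, hC⟩ := hJ.exists_norm_sub_tileIndex_le hp hM
  have h1 := hA.tendsto_inv_pow_mulVec
    (c := fun k => (J (ft^[k] x) - fun i => (tileIndex Γ p M₀ (ft^[k] x) i : ℝ)) +
      fun i => (tileIndex Γ p M₀ x i : ℝ))
    (fun k => (norm_add_le _ _).trans (add_le_add_left (hC _) _))
  have h2 := hlim.sub h1
  rw [sub_zero] at h2
  refine h2.congr fun k => ?_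
  rw [← Matrix.mulVec_sub]
  congr 1
  funext i
  simp [displacement]
  ring

end Beta

end AbelianCover

end

/-! ### The main theorem -/

theorem mainTheorem5 {n b : ℕ}
    {M : Type*} [TopologicalSpace M] [ChartedSpace (EuclideanSpace ℝ (Fin n)) M]
    [IsManifold (𝓡 n) ∞ M] [T2Space M] [CompactSpace M] [ConnectedSpace M]
    (Γ : Module.Basis (Fin b) ℤ (AbelianCover.H1 M))
    {Mt : Type*} [TopologicalSpace Mt] (p : C(Mt, M))
    (hp : AbelianCover.IsUniversalAbelianCover p)
    (f : C(M, M)) (ft : C(Mt, Mt)) (hft : ∀ x, p (ft x) = f (p x))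
    (A : Matrix (Fin b) (Fin b) ℤ) (hA : A = AbelianCover.homologyMatrix Γ f)
    (hexp : AbelianCover.IsExpanding A) :
    -- the matrices inverted below are invertible
    (∀ k : ℕ, IsUnit (AbelianCover.realMatrix A ^ k)) ∧
    (∀ k : ℕ, 1 ≤ k → IsUnit (AbelianCover.realMatrix A ^ k - 1)) ∧
    (∀ (η : Fin b → AbelianCover.ClosedOneForm n M) (x₀ : Mt), AbelianCover.IsDualTo η Γ →
      -- the limit defining `β̃` exists
      (∀ x : Mt, Tendsto
        (fun k : ℕ => ((AbelianCover.realMatrix A) ^ k)⁻¹.mulVec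
          (AbelianCover.abelJacobi p η x₀ (ft^[k] x)))
        atTop (𝓝 (AbelianCover.betaLift A p η x₀ ft x))) ∧
      -- the normalized approximate displacements converge to `β̃`
      (∀ M₀ : Set Mt, AbelianCover.IsFundamentalDomain Γ p M₀ → ∀ x : Mt, Tendsto
        (fun k : ℕ => ((AbelianCover.realMatrix A) ^ k - 1)⁻¹.mulVec
          (fun i => (AbelianCover.displacement Γ p M₀ ft k x i : ℝ)))
        atTop (𝓝 (AbelianCover.betaLift A p η x₀ ft x))) ∧
      -- `β̃` descends to a continuous semiconjugacy `β` from `f` to `Φ_A`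
      (∀ x : Mt, AbelianCover.beta A p η x₀ ft (p x) =
        AbelianCover.toTorus (AbelianCover.betaLift A p η x₀ ft x)) ∧
      Continuous (AbelianCover.beta A p η x₀ ft) ∧
      (∀ x : M, AbelianCover.beta A p η x₀ ft (f x) =
        AbelianCover.toralEndo A (AbelianCover.beta A p η x₀ ft x))) ∧
    -- neither map depends on the one-forms (or the base point) used to define `ι̃`
    (∀ (η η' : Fin b → AbelianCover.ClosedOneForm n M) (x₀ x₀' : Mt),
      AbelianCover.IsDualTo η Γ → AbelianCover.IsDualTo η' Γ →
      AbelianCover.betaLift A p η x₀ ft = AbelianCover.betaLift A p η' x₀' ft ∧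
      AbelianCover.beta A p η x₀ ft = AbelianCover.beta A p η' x₀' ft) := by
  subst hA
  have hpc := hp.pathConnected
  have hlpc := ChartedSpace.locallyPathConnectedSpace (EuclideanSpace ℝ (Fin n)) M
  have hq := hp.isQuotientMap
  have key (η : Fin b → AbelianCover.ClosedOneForm n M) (x₀ : Mt)
      (hη : AbelianCover.IsDualTo η Γ) :=
    (AbelianCover.isEquivariant_abelJacobi hp hη x₀).exists_tendsto hq hft hexp
  have hlift (η : Fin b → AbelianCover.ClosedOneForm n M) (x₀ : Mt)
      (hη : AbelianCover.IsDualTo η Γ) :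
      AbelianCover.betaLift (AbelianCover.homologyMatrix Γ f) p η x₀ ft =
        (key η x₀ hη).choose := by
    funext x
    simp only [AbelianCover.betaLift, ← Matrix.inv_pow']
    exact ((key η x₀ hη).choose_spec.2.2 x).limUnder_eq
  have indep (η η' : Fin b → AbelianCover.ClosedOneForm n M) (x₀ x₀' : Mt)
      (hη : AbelianCover.IsDualTo η Γ) (hη' : AbelianCover.IsDualTo η' Γ) :
      AbelianCover.betaLift (AbelianCover.homologyMatrix Γ f) p η x₀ ft =
        AbelianCover.betaLift (AbelianCover.homologyMatrix Γ f) p η' x₀' ft := by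
    rw [hlift η x₀ hη, hlift η' x₀' hη']
    funext x
    obtain ⟨C, hC⟩ := (AbelianCover.isEquivariant_abelJacobi hp hη x₀).exists_norm_sub_le hq
      (AbelianCover.isEquivariant_abelJacobi hp hη' x₀')
    have h := hexp.tendsto_inv_pow_mulVec (fun k => hC (ft^[k] x))
    have h' := ((key η x₀ hη).choose_spec.2.2 x).sub ((key η' x₀' hη').choose_spec.2.2 x)
    simp only [← Matrix.mulVec_sub] at h'
    exact sub_eq_zero.1 (tendsto_nhds_unique h' h)
  refine ⟨fun k => hexp.isUnit_realMatrix.pow k, fun k hk => hexp.isUnit_pow_sub_one hk, ?_, ?_⟩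
  · intro η x₀ hη
    obtain ⟨hequiv, hsemi, hlim⟩ := (key η x₀ hη).choose_spec
    rw [← hlift η x₀ hη] at hequiv hsemi hlim
    have hbeta := AbelianCover.beta_apply hequiv
    refine ⟨fun x => ?_, fun M₀ hM x => hexp.tendsto_inv_pow_sub_one_mulVec
      ((AbelianCover.isEquivariant_abelJacobi hp hη x₀).tendsto_inv_pow_displacement
        hp.isCoveringMap hexp (hlim x) hM), hbeta, ?_, fun x => ?_⟩
    · simpa only [Matrix.inv_pow'] using hlim x
    -- As `p` is a quotient map, continuity of `β` is tested on the cover.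
    · refine hq.continuous_iff.2 ?_
      rw [show AbelianCover.beta (AbelianCover.homologyMatrix Γ f) p η x₀ ft ∘ p =
        AbelianCover.toTorus ∘ AbelianCover.betaLift (AbelianCover.homologyMatrix Γ f) p η x₀ ft
        from funext hbeta]
      exact AbelianCover.continuous_toTorus.comp hequiv.continuous
    · obtain ⟨y, rfl⟩ := hq.surjective x
      rw [← hft, hbeta, hbeta, hsemi, AbelianCover.toTorus_mulVec]
  · intro η η' x₀ x₀' hη hη'
    have h := indep η η' x₀ x₀' hη hη'
    refine ⟨h, ?_⟩
    funext x
    simp only [AbelianCover.beta, h]
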